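/- **Setting.** Consider $x_{k+1}=f(x_k,u_k,\theta_k,w_k)$ with states $x_k\in\mathbb R^{n_x}$, inputs $u_k\in\mathbb U\subseteq\mathbb R^{\nu}$, unknown parameters $\theta_k\in\Theta\subseteq\mathbb R^{n_\theta}$ and disturbances $w_k\in\mathbb R^{n_w}$; noisy state measurements $\hat x_k=x_k+v_k$; outputs $y_k=h(x_k,u_k,\theta_k)\in\mathbb R^{n_y}$; desired states $\mathbb X=\{x: D_ix\le d_i,\ i=1,\dots,r\}$; and an output target $y_{\mathrm d}$. Write $\Delta\theta_k=\theta_{k+1}-\theta_k$, $\|x\|_Q^2=x^\top Qx$, $\|x\|_{\mathbb X}=\inf_{s\in\mathbb X}\|x-s\|$. Let $Q,R,T\succ0$ and $q_{\xi,i}>0$. Let $$\mathbb S(\theta)=\{(x,u,y)\in\mathbb X\times\mathbb U\times\mathbb R^{n_y}: f(x,u,\theta,0)=x,\ y=h(x,u,\theta)\},$$ and let $(x_{\mathrm{rd},\theta},u_{\mathrm{rd},\theta},y_{\mathrm{rd},\theta})$ minimize $\|y_{\mathrm d}-y\|_T^2$ over $\mathbb S(\theta)$. For an input sequence $\mathbf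 u$ let $x_{\mathbf u}(k,x,\theta)$ be the solution with $w\equiv0$ and constant $\theta$ started at $x$. **Assumptions.** 1. For $\theta\in\Theta$ the sets $\mathbb S(\theta)$ are non-empty, closed and uniformly bounded; $f,h$ are $C^1$ and Lipschitz (uniformly for $u\in\mathbb U$, $\theta\in\Theta$ and all $x,w$); $\mathbb U,\Theta$ are convex and compact. 2. $f(x,u,\theta,w)=f(x,u,0,w)+G(x,u,w)\theta$. 3. (a) There are maps $g_x,g_u$ of $(y,\theta)$ with $x=g_x(y,\theta)$, $u=g_u(y,\theta)$ for all $\theta\in\Theta$, $(x,u,y)\in\mathbb S(\theta)$, and a constant $L_g$ with $\|g_x(y,\theta)-g_x(\tilde y,\tilde\theta)\|_Q^2+\|g_u(y,\theta)-g_u(\tilde y,\tilde\theta)\|_R^2\le L_g(\|y-\tilde y\|_T^2+\|\theta-\tilde\theta\|^2)$ for all $\theta,\tilde\theta\in\Theta$, $y,\tilde y\in\mathbb R^{n_y}$. (b) If $\theta\in\Theta$ and $\tilde y$ is a convex combination of two outputs occurring in $\mathbb S(\theta)$, then $(g_x(\tilde y,\theta),g_u(\tilde y,\theta),\tilde y)\in\mathbb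 S(\theta)$. (c) $y_{\mathrm{rd},\theta}=y_{\mathrm d}$ for all $\theta\in\Theta$. (d) There is $L_s$ with $\min_{(\tilde x,\tilde u,\tilde y)\in\mathbb S(\tilde\theta)}\|y-\tilde y\|_T^2\le L_s\|\theta-\tilde\theta\|^2$ for all $\theta,\tilde\theta\in\Theta$, $(x,u,y)\in\mathbb S(\theta)$. 4. (Open-loop exponential stability) There are $C_\rho\ge1$, $\rho\in(0,1)$ such that for all $\theta\in\Theta$, all $(x_s,u_s)\in\mathbb R^{n_x}\times\mathbb U$ with $f(x_s,u_s,\theta,0)=x_s$, all $x$ and all $k\ge0$, the solution under the constant input $u_s$ satisfies $\|x_{u_s}(k,x,\theta)-x_s\|\le C_\rho\rho^k\|x-x_s\|$. 5. The output does not depend on the parameter: $h(x,u,\theta)=h(x,u,\theta')$ for all $x$, all $u\in\mathbb U$ and all $\theta,\theta'\in\Theta$. **Controller.** With $\ell(x,u,x_s,u_s)=\|x-x_s\|_Q^2+\|u-u_s\|_R^2+\sum_iq_{\xi,i}\max\{D_ix-d_i,0\}^2$, $V_f(x,x_s,u_s,\theta)=\sum_{k=0}^{M-1}\ell(x_{u_s}(k,x,\theta),u_s,x_s,u_s)$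 and $\mathcal J_N(x,\theta,\mathbf u,x_s,u_s)=\sum_{k=0}^{N-1}\ell(x_{\mathbf u}(k,x,\theta),\mathbf u_k,x_s,u_s)+\omega V_f(x_{\mathbf u}(N,x,\theta),x_s,u_s,\theta)$, the MPC problem at $(x,\theta)$ is $$\mathcal J_N^\star(x,\theta)=\min_{\mathbf u\in\mathbb U^N,\ (x_s,u_s,y_s)\in\mathbb S(\theta)}\mathcal J_N(x,\theta,\mathbf u,x_s,u_s)+\|y_s-y_{\mathrm d}\|_T^2 .$$ Fix a selection of minimizers $\mathbf u^\star_{x,\theta}$, $(x^\star_s,u^\star_s,y^\star_s)$, and let $\pi(x,\theta)$ be the first element of $\mathbf u^\star_{x,\theta}$. Say that $(N,M,\omega)$ has *nominal decrease* $\alpha>0$ (for this selection) if for all $x$ and all $\theta\in\Theta$ $$\mathcal J_N^\star(f(x,\pi(x,\theta),\theta,0),\theta)-\mathcal J_N^\star(x,\theta)\le-\alpha\,\ell(x,\pi(x,\theta),x^\star_s,u^\star_s).$$ Let $\mathbb X_0,\mathbb W,\mathbb V$ be compact. A gain $\Gamma\succ0$ is *admissible* if $\Phi\Gamma\Phi^\top\preceq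 I$ for all $\Phi=G(x+v,u,0)$ with $u\in\mathbb U$, $v\in\mathbb V$, and $x$ reachable from $\mathbb X_0$ with inputs in $\mathbb U$, parameters in $\Theta$ and disturbances in $\mathbb W$. The closed loop applies $u_k=\pi(\hat x_k,\hat\theta_k)$, where $$\tilde\theta_{k+1}=\hat\theta_k+\Gamma\hat\Phi_k^\top\big(\hat x_{k+1}-f(\hat x_k,u_k,\hat\theta_k,0)\big),\quad \hat\Phi_k=G(\hat x_k,u_k,0),\qquad \hat\theta_{k+1}=\arg\min_{\theta\in\Theta}\|\theta-\tilde\theta_{k+1}\|_{\Gamma^{-1}}^2 .$$ **Theorem.** Under Assumptions 1-5: (i) For all $\omega\ge1$ and $M\ge0$ there is $N\ge1$ such that $(N,M,\omega)$ has nominal decrease with some $\alpha>0$, uniformly over the selections of minimizers. Moreover, for all sufficiently large $M$ there is $\underline\omega\ge1$ such that the same holds for every $\omega>\underline\omega$ and every $N\ge1$. Minimizers of the MPC problem exist for all $N\ge1$, $M\ge0$, $\omega>0$. (ii) An admissible gain $\Gamma\succ0$ exists. (iii) For all $N\ge1$, $M\ge0$, $\omega>0$ and every selection of minimizers with nominal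 decrease for some $\alpha>0$, and for every admissible gain $\Gamma$, there are constants $C_1,C_2>0$ such that every closed-loop trajectory with $x_0\in\mathbb X_0$, $\hat\theta_0\in\Theta$ and $\theta_k\in\Theta$, $w_k\in\mathbb W$, $v_k\in\mathbb V$ for all $k\ge0$ satisfies, for all $K\ge0$, $$\sum_{k=0}^{K-1}\big[\|y_k-y_{\mathrm{rd},\theta_k}\|^2+\|x_k\|_{\mathbb X}^2\big]\le C_1\sum_{k=0}^{K-1}\big[\|w_k\|^2+\|v_k\|^2+\|\Delta\theta_k\|\big]+C_2\big(\|\theta_0-\hat\theta_0\|^2+\|x_0-x_{\mathrm{rd},\theta_0}\|^2\big).$$ -/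

import Mathlib

namespace AdaptiveMPC

/-- Euclidean space of dimension `n`, with the Euclidean norm. -/
abbrev Vec (n : ℕ) := EuclideanSpace ℝ (Fin n)

/-- Matrix-vector product on Euclidean spaces. -/
noncomputable def mulV {m n : ℕ} (A : Matrix (Fin m) (Fin n) ℝ) (x : Vec n) : Vec m :=
  WithLp.toLp 2 (A.mulVec x.ofLp)

/-- The weighted squared norm `‖x‖_Q ^ 2 = xᵀ Q x`. -/
noncomputable def wsq {n : ℕ} (Q : Matrix (Fin n) (Fin n) ℝ) (x : Vec n) : ℝ :=
  x.ofLp ⬝ᵥ Q.mulVec x.ofLp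

/-- The data of the control problem and of the controller, without any assumption on them:
dynamics `f x u θ w`, regressor `G x u w`, output map `h x u θ`, input set `U`, parameter set
`Θ`, half-space state constraints `⟪D i, x⟫ ≤ d i`, output target `yd`, weights `Q R T` and
weights `q i` of the soft state constraints. -/
structure Problem (nx nu np nw ny r : ℕ) where
  f : Vec nx → Vec nu → Vec np → Vec nw → Vec nx
  G : Vec nx → Vec nu → Vec nw → Matrix (Fin nx) (Fin np) ℝ
  h : Vec nx → Vec nu → Vec np → Vec ny
  U : Set (Vec nu)
  Θ : Set (Vec np)
  D : Fin r → Vec nx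
  d : Fin r → ℝ
  yd : Vec ny
  Q : Matrix (Fin nx) (Fin nx) ℝ
  R : Matrix (Fin nu) (Fin nu) ℝ
  T : Matrix (Fin ny) (Fin ny) ℝ
  q : Fin r → ℝ

namespace Problem

variable {nx nu np nw ny r : ℕ} (P : Problem nx nu np nw ny r)

/-- The polyhedral set of desired states. -/
def X : Set (Vec nx) := {x | ∀ i, inner ℝ (P.D i) x ≤ P.d i}

/-- The feasible setpoints `(x, u, y)` for the parameter `θ`. -/
def S (θ : Vec np) : Set (Vec nx × Vec nu × Vec ny) :=
  {s | s.1 ∈ P.X ∧ s.2.1 ∈ P.U ∧ P.f s.1 s.2.1 θ 0 = s.1 ∧ s.2.2 = P.h s.1 s.2.1 θ}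

/-- `s` is a feasible setpoint whose output is closest to the target in the norm `‖·‖_T`. -/
def IsOptimalSetpoint (θ : Vec np) (s : Vec nx × Vec nu × Vec ny) : Prop :=
  s ∈ P.S θ ∧ ∀ s' ∈ P.S θ, wsq P.T (P.yd - s.2.2) ≤ wsq P.T (P.yd - s'.2.2)

/-- The disturbance-free solution with constant parameter `θ`, started at `x`. -/
def traj (u : ℕ → Vec nu) (x : Vec nx) (θ : Vec np) : ℕ → Vec nx
  | 0 => x
  | k + 1 => P.f (traj u x θ k) (u k) θ 0

/-- The weighting matrices and weights are positive. -/
structure PositiveWeights : Prop where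
  Q : P.Q.PosDef
  R : P.R.PosDef
  T : P.T.PosDef
  q : ∀ i, 0 < P.q i

/-- Standing assumptions: feasible setpoints, smooth Lipschitz dynamics and output,
compact convex input and parameter sets. -/
structure Regular : Prop where
  nonempty : ∀ θ ∈ P.Θ, (P.S θ).Nonempty
  closed : ∀ θ ∈ P.Θ, IsClosed (P.S θ)
  bounded : ∃ B : ℝ, ∀ θ ∈ P.Θ, ∀ s ∈ P.S θ, ‖s‖ ≤ B
  contDiff_f : ContDiff ℝ 1
    (fun z : Vec nx × Vec nu × Vec np × Vec nw => P.f z.1 z.2.1 z.2.2.1 z.2.2.2)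
  contDiff_h : ContDiff ℝ 1 (fun z : Vec nx × Vec nu × Vec np => P.h z.1 z.2.1 z.2.2)
  lipschitz_f : ∃ L : ℝ, ∀ x x' : Vec nx, ∀ u ∈ P.U, ∀ u' ∈ P.U, ∀ θ ∈ P.Θ, ∀ θ' ∈ P.Θ,
    ∀ w w' : Vec nw, ‖P.f x u θ w - P.f x' u' θ' w'‖
      ≤ L * (‖x - x'‖ + ‖u - u'‖ + ‖θ - θ'‖ + ‖w - w'‖)
  lipschitz_h : ∃ L : ℝ, ∀ x x' : Vec nx, ∀ u ∈ P.U, ∀ u' ∈ P.U, ∀ θ ∈ P.Θ, ∀ θ' ∈ P.Θ,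
    ‖P.h x u θ - P.h x' u' θ'‖ ≤ L * (‖x - x'‖ + ‖u - u'‖ + ‖θ - θ'‖)
  convex_U : Convex ℝ P.U
  compact_U : IsCompact P.U
  convex_Θ : Convex ℝ P.Θ
  compact_Θ : IsCompact P.Θ

/-- The dynamics are linear in the parameter. -/
def LinearlyParametrized : Prop :=
  ∀ x u θ w, P.f x u θ w = P.f x u 0 w + mulV (P.G x u w) θ

/-- Regularity of the steady states: setpoints are Lipschitz functions of output and parameter,
the feasible outputs are convex, the target is optimal, and the feasible outputs depend
Lipschitz continuously on the parameter. -/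
structure SteadyRegular : Prop where
  setpoint_map : ∃ (gx : Vec ny → Vec np → Vec nx) (gu : Vec ny → Vec np → Vec nu),
    (∀ θ ∈ P.Θ, ∀ s ∈ P.S θ, s.1 = gx s.2.2 θ ∧ s.2.1 = gu s.2.2 θ) ∧
    (∃ L : ℝ, 0 ≤ L ∧ ∀ θ ∈ P.Θ, ∀ θ' ∈ P.Θ, ∀ y y' : Vec ny,
      wsq P.Q (gx y θ - gx y' θ') + wsq P.R (gu y θ - gu y' θ')
        ≤ L * (wsq P.T (y - y') + ‖θ - θ'‖ ^ 2)) ∧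
    (∀ θ ∈ P.Θ, ∀ s₁ ∈ P.S θ, ∀ s₂ ∈ P.S θ, ∀ β ∈ Set.Icc (0 : ℝ) 1,
      (gx (β • s₁.2.2 + (1 - β) • s₂.2.2) θ, gu (β • s₁.2.2 + (1 - β) • s₂.2.2) θ,
        β • s₁.2.2 + (1 - β) • s₂.2.2) ∈ P.S θ)
  target_feasible : ∀ θ ∈ P.Θ, ∀ s, P.IsOptimalSetpoint θ s → s.2.2 = P.yd
  output_lipschitz : ∃ L : ℝ, ∀ θ ∈ P.Θ, ∀ θ' ∈ P.Θ, ∀ s ∈ P.S θ, ∃ s' ∈ P.S θ',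
    wsq P.T (s.2.2 - s'.2.2) ≤ L * ‖θ - θ'‖ ^ 2

/-- Open-loop exponential stability of every steady state under its constant input. -/
def OpenLoopStable : Prop :=
  ∃ C ρ : ℝ, 1 ≤ C ∧ 0 < ρ ∧ ρ < 1 ∧ ∀ θ ∈ P.Θ, ∀ xs : Vec nx, ∀ us ∈ P.U,
    P.f xs us θ 0 = xs → ∀ (x : Vec nx) (k : ℕ),
      ‖P.traj (fun _ => us) x θ k - xs‖ ≤ C * ρ ^ k * ‖x - xs‖

/-- The stage cost with soft state constraints. -/
noncomputable def stageCost (x : Vec nx) (u : Vec nu) (xs : Vec nx) (us : Vec nu) : ℝ :=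
  wsq P.Q (x - xs) + wsq P.R (u - us)
    + ∑ i, P.q i * (max (inner ℝ (P.D i) x - P.d i) 0) ^ 2

/-- The finite-tail terminal penalty: the cost of the rollout of length `M` of the constant
input `us`. -/
noncomputable def tailCost (M : ℕ) (x xs : Vec nx) (us : Vec nu) (θ : Vec np) : ℝ :=
  ∑ k ∈ Finset.range M, P.stageCost (P.traj (fun _ => us) x θ k) us xs us

/-- A finite input sequence as a function on `ℕ`; the values beyond its length, set to `0`,
do not enter the cost. -/
def extend {N : ℕ} (ū : Fin N → Vec nu) (k : ℕ) : Vec nu :=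
  if hk : k < N then ū ⟨k, hk⟩ else 0

/-- The finite-horizon cost. -/
noncomputable def horizonCost (N M : ℕ) (ω : ℝ) (x : Vec nx) (θ : Vec np)
    (ū : Fin N → Vec nu) (xs : Vec nx) (us : Vec nu) : ℝ :=
  (∑ k : Fin N, P.stageCost (P.traj (extend ū) x θ k) (ū k) xs us)
    + ω * P.tailCost M (P.traj (extend ū) x θ N) xs us θ

/-- The objective of the tracking MPC, including the output offset cost. -/
noncomputable def mpcCost (N M : ℕ) (ω : ℝ) (x : Vec nx) (θ : Vec np)
    (ū : Fin N → Vec nu) (s : Vec nx × Vec nu × Vec ny) : ℝ :=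
  P.horizonCost N M ω x θ ū s.1 s.2.1 + wsq P.T (s.2.2 - P.yd)

/-- `(ū, s)` is a minimizer of the tracking MPC problem at `(x, θ)`. -/
def IsMPCMinimizer (N M : ℕ) (ω : ℝ) (x : Vec nx) (θ : Vec np)
    (ū : Fin N → Vec nu) (s : Vec nx × Vec nu × Vec ny) : Prop :=
  (∀ k, ū k ∈ P.U) ∧ s ∈ P.S θ ∧
    ∀ ū' : Fin N → Vec nu, (∀ k, ū' k ∈ P.U) → ∀ s' ∈ P.S θ,
      P.mpcCost N M ω x θ ū s ≤ P.mpcCost N M ω x θ ū' s'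

/-- An MPC law: a choice of a minimizer of the MPC problem for every state and every parameter
in the parameter set. -/
structure MPCLaw (N M : ℕ) (ω : ℝ) where
  inputs : Vec nx → Vec np → Fin N → Vec nu
  setpoint : Vec nx → Vec np → Vec nx × Vec nu × Vec ny
  isMin : ∀ x, ∀ θ ∈ P.Θ, P.IsMPCMinimizer N M ω x θ (inputs x θ) (setpoint x θ)

namespace MPCLaw

variable {P} {N M : ℕ} {ω : ℝ} (law : P.MPCLaw N M ω)

/-- The feedback: the first element of the minimizing input sequence (for `1 ≤ N`). -/
def policy (x : Vec nx) (θ : Vec np) : Vec nu := extend (law.inputs x θ) 0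

/-- The minimum of the MPC problem. -/
noncomputable def value (x : Vec nx) (θ : Vec np) : ℝ :=
  P.mpcCost N M ω x θ (law.inputs x θ) (law.setpoint x θ)

/-- The minimum decreases along the nominal closed loop, at a rate of `α` times the stage
cost. -/
def NominalDecrease (α : ℝ) : Prop :=
  ∀ x, ∀ θ ∈ P.Θ,
    law.value (P.f x (law.policy x θ) θ 0) θ - law.value x θ
      ≤ -α * P.stageCost x (law.policy x θ) (law.setpoint x θ).1 (law.setpoint x θ).2.1

end MPCLaw

/-- The states that can be reached from `X₀` with admissible inputs, parameters and
disturbances. -/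
inductive Reachable (X₀ : Set (Vec nx)) (W : Set (Vec nw)) : Vec nx → Prop
  | init (x : Vec nx) (hx : x ∈ X₀) : Reachable X₀ W x
  | step (x : Vec nx) (u : Vec nu) (θ : Vec np) (w : Vec nw) (hx : Reachable X₀ W x)
      (hu : u ∈ P.U) (hθ : θ ∈ P.Θ) (hw : w ∈ W) : Reachable X₀ W (P.f x u θ w)

/-- Admissible gain: `Γ ≻ 0` and `Φ Γ Φᵀ ⪯ I` for the regressor `Φ = G(x + v, u, 0)` at every
reachable state `x`, admissible input `u` and measurement noise `v`. -/
def AdmissibleGain (X₀ : Set (Vec nx)) (W : Set (Vec nw)) (V : Set (Vec nx))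
    (Γ : Matrix (Fin np) (Fin np) ℝ) : Prop :=
  Γ.PosDef ∧ ∀ x, P.Reachable X₀ W x → ∀ u ∈ P.U, ∀ v ∈ V,
    (1 - P.G (x + v) u 0 * Γ * (P.G (x + v) u 0).transpose).PosSemidef

/-- `θ'` is the projection of `θ` onto the parameter set in the norm `‖·‖_{Γ⁻¹}`. -/
def IsProjection (Γ : Matrix (Fin np) (Fin np) ℝ) (θ θ' : Vec np) : Prop :=
  θ' ∈ P.Θ ∧ ∀ η ∈ P.Θ, wsq Γ⁻¹ (θ' - θ) ≤ wsq Γ⁻¹ (η - θ)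

/-- The adaptive closed loop: true states `x`, measured states `xm`, inputs `u`, outputs `y`,
true parameters `θ`, parameter estimates `θe`, disturbances `w`, measurement noise `v`. -/
structure ClosedLoop {N M : ℕ} {ω : ℝ} (law : P.MPCLaw N M ω)
    (Γ : Matrix (Fin np) (Fin np) ℝ) (x xm : ℕ → Vec nx) (u : ℕ → Vec nu) (y : ℕ → Vec ny)
    (θ θe : ℕ → Vec np) (w : ℕ → Vec nw) (v : ℕ → Vec nx) : Prop where
  measurement : ∀ k, xm k = x k + v k
  input : ∀ k, u k = law.policy (xm k) (θe k)
  dynamics : ∀ k, x (k + 1) = P.f (x k) (u k) (θ k) (w k)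
  output : ∀ k, y k = P.h (x k) (u k) (θ k)
  adaptation : ∀ k, P.IsProjection Γ
    (θe k + mulV (Γ * (P.G (xm k) (u k) 0).transpose)
      (xm (k + 1) - P.f (xm k) (u k) (θe k) 0)) (θe (k + 1))

end Problem

end AdaptiveMPC

/-! Two storage functions carry the closed-loop bound: the optimal MPC value `J` at the measured
state and the estimate, and the parameter error `E` in the norm of `Γ⁻¹`. By linearity in the
parameter, the one-step prediction error is `z + d`, where `z = Φ (θ - θe)` is caused by the wrong
estimate and `d` by disturbance and noise alone. The value satisfies `J⁺ ≤ (1 - c) J + C (‖z‖² +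
‖d‖²)` (`exists_value_contraction`), and the projected gradient step gives `E⁺ + ‖z‖² ≤ E + ‖d‖² +
Cp ‖Δθ‖` (`IsProjection.wsq_error_le`, `exists_wsq_sub_le`). Summing both eliminates `z`
(`sum_le_of_contraction`), and `J` dominates the output error and the constraint violation up to
noise (`exists_output_le`). Only `z` has to be summable, so the estimate need not converge.

The contraction has three ingredients. The nominal decrease is `α ℓ`. The first stage cost `ℓ`
bounds the whole value (`exists_value_le_stageCost`): moving the artificial setpoint by a fraction
`δ` towards the target costs order `δ²` in tracking but saves order `δ` in offset. Finally, the
value is continuous up to a factor `1 + ε` (`exists_value_le_value`), and `ε` is absorbed by the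
decrease.

Nominal decrease follows from the shifted optimal inputs, continued by the steady-state input. For a
long horizon, some predicted stage cost is small by averaging, and switching there is cheap. For
large `M` and `ω`, the terminal penalty is a Lyapunov function. Open-loop stability bounds the
reachable states, hence the regressors, which gives an admissible gain. -/

namespace AdaptiveMPC

/-! ### Weighted quadratic forms, projections and the gradient step -/

section QuadraticForms

variable {m n : ℕ}

/-- The bilinear form `xᵀ A y`. -/
noncomputable def bil (A : Matrix (Fin m) (Fin n) ℝ) (x : Vec m) (y : Vec n) : ℝ :=
  x.ofLp ⬝ᵥ A.mulVec y.ofLp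

theorem wsq_eq_bil (A : Matrix (Fin n) (Fin n) ℝ) (x : Vec n) : wsq A x = bil A x x := rfl

theorem bil_add_left (A : Matrix (Fin m) (Fin n) ℝ) (x x' : Vec m) (y : Vec n) :
    bil A (x + x') y = bil A x y + bil A x' y := by
  simp [bil, add_dotProduct]

theorem bil_add_right (A : Matrix (Fin m) (Fin n) ℝ) (x : Vec m) (y y' : Vec n) :
    bil A x (y + y') = bil A x y + bil A x y' := by
  simp [bil, Matrix.mulVec_add, dotProduct_add]

theorem bil_smul_left (A : Matrix (Fin m) (Fin n) ℝ) (c : ℝ) (x : Vec m) (y : Vec n) :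
    bil A (c • x) y = c * bil A x y := by
  simp [bil, smul_dotProduct]

theorem bil_smul_right (A : Matrix (Fin m) (Fin n) ℝ) (c : ℝ) (x : Vec m) (y : Vec n) :
    bil A x (c • y) = c * bil A x y := by
  simp [bil, Matrix.mulVec_smul, dotProduct_smul]

theorem bil_comm {A : Matrix (Fin n) (Fin n) ℝ} (hA : A.IsHermitian) (x y : Vec n) :
    bil A x y = bil A y x := by
  have h : A.transpose = A := by simpa [Matrix.IsHermitian] using hA
  unfold bil
  rw [Matrix.dotProduct_mulVec, dotProduct_comm, ← Matrix.mulVec_transpose, h]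

theorem wsq_add {A : Matrix (Fin n) (Fin n) ℝ} (hA : A.IsHermitian) (x y : Vec n) :
    wsq A (x + y) = wsq A x + 2 * bil A x y + wsq A y := by
  simp only [wsq_eq_bil, bil_add_left, bil_add_right, bil_comm hA y x]
  ring

theorem wsq_smul (A : Matrix (Fin n) (Fin n) ℝ) (c : ℝ) (x : Vec n) :
    wsq A (c • x) = c ^ 2 * wsq A x := by
  simp only [wsq_eq_bil, bil_smul_left, bil_smul_right]
  ring

theorem wsq_neg (A : Matrix (Fin n) (Fin n) ℝ) (x : Vec n) : wsq A (-x) = wsq A x := by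
  rw [← neg_one_smul ℝ x, wsq_smul]; ring

theorem wsq_sub_comm (A : Matrix (Fin n) (Fin n) ℝ) (x y : Vec n) :
    wsq A (x - y) = wsq A (y - x) := by
  rw [← neg_sub, wsq_neg]

theorem wsq_nonneg {A : Matrix (Fin n) (Fin n) ℝ} (hA : A.PosSemidef) (x : Vec n) :
    0 ≤ wsq A x := by
  simpa [wsq] using hA.dotProduct_mulVec_nonneg x.ofLp

/-- Young's inequality: expand the form at `ε • x - y` and divide by `ε`. -/
theorem wsq_add_le {A : Matrix (Fin n) (Fin n) ℝ} (hA : A.PosSemidef) {ε : ℝ} (hε : 0 < ε)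
    (x y : Vec n) : wsq A (x + y) ≤ (1 + ε) * wsq A x + (1 + ε⁻¹) * wsq A y := by
  have h := wsq_nonneg hA (ε • x + (-1 : ℝ) • y)
  rw [wsq_add hA.isHermitian, wsq_smul, wsq_smul, bil_smul_left, bil_smul_right] at h
  rw [wsq_add hA.isHermitian]
  have h2 := mul_nonneg (inv_pos.2 hε).le h
  have h3 : ε⁻¹ * (ε ^ 2 * wsq A x + 2 * (ε * (-1 * bil A x y)) + (-1) ^ 2 * wsq A y)
      = ε * wsq A x - 2 * bil A x y + ε⁻¹ * wsq A y := by
    field_simp; ring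
  rw [h3] at h2
  linarith

theorem continuous_wsq (A : Matrix (Fin n) (Fin n) ℝ) : Continuous (wsq A) := by
  have : wsq A = fun x : Vec n => inner ℝ x (Matrix.toEuclideanCLM (n := Fin n) (𝕜 := ℝ) A x) := by
    funext x; rw [Matrix.inner_toEuclideanCLM]; rfl
  rw [this]; fun_prop

theorem exists_bil_le (A : Matrix (Fin n) (Fin n) ℝ) :
    ∃ C : ℝ, 0 < C ∧ ∀ x y : Vec n, |bil A x y| ≤ C * ‖x‖ * ‖y‖ := by
  refine ⟨‖Matrix.toEuclideanCLM (n := Fin n) (𝕜 := ℝ) A‖ + 1, by positivity, fun x y => ?_⟩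
  have : bil A x y = inner ℝ x (Matrix.toEuclideanCLM (n := Fin n) (𝕜 := ℝ) A y) := by
    rw [Matrix.inner_toEuclideanCLM]; rfl
  rw [this]
  refine (abs_real_inner_le_norm _ _).trans ?_
  have h := (Matrix.toEuclideanCLM (n := Fin n) (𝕜 := ℝ) A).le_opNorm y
  nlinarith [mul_le_mul_of_nonneg_left h (norm_nonneg x), mul_nonneg (norm_nonneg x) (norm_nonneg y)]

theorem exists_wsq_le (A : Matrix (Fin n) (Fin n) ℝ) :
    ∃ C : ℝ, 0 < C ∧ ∀ x : Vec n, wsq A x ≤ C * ‖x‖ ^ 2 := by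
  obtain ⟨C, hC, h⟩ := exists_bil_le A
  exact ⟨C, hC, fun x => (le_abs_self _).trans ((h x x).trans_eq (by ring))⟩

theorem exists_norm_sq_le_wsq {A : Matrix (Fin n) (Fin n) ℝ} (hA : A.PosDef) :
    ∃ C : ℝ, 0 < C ∧ ∀ x : Vec n, ‖x‖ ^ 2 ≤ C * wsq A x := by
  -- In dimension zero the sphere is empty. Otherwise the constant is the inverse of the minimum on
  -- the sphere, by homogeneity.
  rcases (Metric.sphere (0 : Vec n) 1).eq_empty_or_nonempty with he | hne
  · refine ⟨1, one_pos, fun x => ?_⟩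
    have hx : x = 0 := by
      by_contra hx
      have : ‖x‖⁻¹ • x ∈ Metric.sphere (0 : Vec n) 1 := by
        simp [norm_smul, norm_ne_zero_iff.2 hx]
      simp [he] at this
    subst hx
    simpa using wsq_nonneg hA.posSemidef 0
  · obtain ⟨z, hz, hmin⟩ := (isCompact_sphere (0 : Vec n) 1).exists_isMinOn hne
      (continuous_wsq A).continuousOn
    have hz0 : z.ofLp ≠ 0 := by
      intro h
      have : z = 0 := by ext i; simp [h]
      simp [this] at hz
    have hpos : 0 < wsq A z := by
      simpa [wsq] using hA.dotProduct_mulVec_pos hz0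
    refine ⟨(wsq A z)⁻¹, inv_pos.2 hpos, fun x => ?_⟩
    by_cases hx : x = 0
    · subst hx
      simpa using mul_nonneg (inv_pos.2 hpos).le (wsq_nonneg hA.posSemidef 0)
    have hs : ‖x‖⁻¹ • x ∈ Metric.sphere (0 : Vec n) 1 := by
      simp [norm_smul, norm_ne_zero_iff.2 hx]
    have h := isMinOn_iff.1 hmin _ hs
    rw [wsq_smul] at h
    have hn : 0 < ‖x‖ := norm_pos_iff.2 hx
    rw [inv_mul_eq_div, le_div_iff₀ hpos]
    calc ‖x‖ ^ 2 * wsq A z ≤ ‖x‖ ^ 2 * ((‖x‖⁻¹) ^ 2 * wsq A x) := by gcongr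
      _ = wsq A x := by field_simp

/-- Obtuse-angle inequality for the projection onto a convex set in a weighted norm. -/
theorem wsq_sub_le_of_isMinOn {A : Matrix (Fin n) (Fin n) ℝ} (hA : A.PosSemidef)
    {K : Set (Vec n)} (hK : Convex ℝ K) {z p : Vec n} (hp : p ∈ K)
    (hmin : ∀ η ∈ K, wsq A (p - z) ≤ wsq A (η - z)) {η : Vec n} (hη : η ∈ K) :
    wsq A (p - η) ≤ wsq A (z - η) := by
  -- First-order optimality of `p` towards `η`. If the linear term `b` were negative, a step `t`
  -- with `t (c + 1) ≤ -b` would give `2 t b + t² c ≤ t b < 0`.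
  have key : 0 ≤ bil A (p - z) (η - p) := by
    by_contra! hneg
    set b := bil A (p - z) (η - p)
    set c := wsq A (η - p) with hc
    have hc0 : 0 ≤ c := wsq_nonneg hA _
    have hstep : ∀ t : ℝ, 0 ≤ t → t ≤ 1 → 0 ≤ 2 * t * b + t ^ 2 * c := by
      intro t ht0 ht1
      have hmem : p + t • (η - p) ∈ K := hK.add_smul_sub_mem hp hη ⟨ht0, ht1⟩
      have h := hmin _ hmem
      have e : p + t • (η - p) - z = (p - z) + t • (η - p) := by abel
      rw [e, wsq_add hA.isHermitian, bil_smul_right, wsq_smul] at h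
      linarith
    have ht : 0 < min 1 (-b / (c + 1)) := lt_min one_pos (div_pos (by linarith) (by linarith))
    have h1 := hstep _ ht.le (min_le_left _ _)
    have h2 : min 1 (-b / (c + 1)) * (c + 1) ≤ -b := by
      rw [← le_div_iff₀ (by linarith)]; exact min_le_right _ _
    set t := min 1 (-b / (c + 1))
    nlinarith [mul_pos ht ht]
  have e : z - η = (z - p) + (p - η) := by abel
  rw [e, wsq_add hA.isHermitian]
  have e2 : bil A (z - p) (p - η) = bil A (p - z) (η - p) := by
    rw [← neg_sub p z, ← neg_sub η p, ← neg_one_smul ℝ (p - z), ← neg_one_smul ℝ (η - p),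
      bil_smul_left, bil_smul_right]
    ring
  rw [e2]
  linarith [wsq_nonneg hA (z - p)]

theorem inner_mulV (A : Matrix (Fin m) (Fin n) ℝ) (x : Vec m) (y : Vec n) :
    inner ℝ x (mulV A y) = bil A x y := by
  simp [bil, mulV, EuclideanSpace.inner_eq_star_dotProduct, dotProduct_comm]

theorem mulV_sub (A : Matrix (Fin m) (Fin n) ℝ) (x y : Vec n) :
    mulV A (x - y) = mulV A x - mulV A y := by
  simp [mulV, Matrix.mulVec_sub]

/-- Expansion of the squared parameter error after a gradient step with gain `Γ`. -/
theorem wsq_inv_add_gain {Γ : Matrix (Fin n) (Fin n) ℝ} (hΓ : Γ.PosDef)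
    (Φ : Matrix (Fin m) (Fin n) ℝ) (a : Vec n) (e : Vec m) :
    wsq Γ⁻¹ (a + mulV (Γ * Φ.transpose) e)
      = wsq Γ⁻¹ a + 2 * inner ℝ e (mulV Φ a) + wsq (Φ * Γ * Φ.transpose) e := by
  have hu : IsUnit Γ.det := (Matrix.isUnit_iff_isUnit_det _).1 hΓ.isUnit
  have hT : Γ.transpose = Γ := by simpa [Matrix.IsHermitian] using hΓ.isHermitian
  rw [wsq_add hΓ.inv.isHermitian, inner_mulV]
  congr 1
  · congr 2
    rw [bil_comm hΓ.inv.isHermitian]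
    unfold bil mulV
    rw [Matrix.dotProduct_mulVec, Matrix.dotProduct_mulVec, ← Matrix.mulVec_transpose,
      ← Matrix.mulVec_transpose, Matrix.mulVec_mulVec, Matrix.transpose_nonsing_inv, hT,
      ← Matrix.mul_assoc, Matrix.nonsing_inv_mul _ hu, Matrix.one_mul]
  · unfold wsq mulV
    dsimp only
    rw [Matrix.mulVec_mulVec, ← Matrix.mul_assoc, Matrix.nonsing_inv_mul _ hu, Matrix.one_mul,
      ← Matrix.vecMul_transpose, ← Matrix.dotProduct_mulVec, Matrix.mulVec_mulVec]
    simp [hT]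

theorem wsq_le_of_posSemidef_one_sub {A : Matrix (Fin n) (Fin n) ℝ}
    (hA : (1 - A).PosSemidef) (x : Vec n) : wsq A x ≤ ‖x‖ ^ 2 := by
  have h := wsq_nonneg hA x
  have e : wsq (1 - A) x = ‖x‖ ^ 2 - wsq A x := by
    rw [EuclideanSpace.real_norm_sq_eq]
    simp only [wsq, Matrix.sub_mulVec, Matrix.one_mulVec, dotProduct_sub]
    simp only [dotProduct, sq]
  linarith

theorem mulV_smul (A : Matrix (Fin m) (Fin n) ℝ) (c : ℝ) (x : Vec n) :
    mulV A (c • x) = c • mulV A x := by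
  simp [mulV, Matrix.mulVec_smul]

/-- An operator bound for a matrix bounds the transposed matrix. -/
theorem norm_mulV_transpose_le {A : Matrix (Fin m) (Fin n) ℝ} {B : ℝ}
    (hB : 0 ≤ B) (h : ∀ x, ‖mulV A x‖ ≤ B * ‖x‖) (y : Vec m) : ‖mulV A.transpose y‖ ≤ B * ‖y‖ := by
  have e : inner ℝ y (mulV A (mulV A.transpose y)) = ‖mulV A.transpose y‖ ^ 2 := by
    rw [inner_mulV, EuclideanSpace.real_norm_sq_eq]
    simp only [bil, mulV]
    rw [Matrix.dotProduct_mulVec, ← Matrix.mulVec_transpose]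
    simp only [dotProduct, sq]
  have h1 := real_inner_le_norm y (mulV A (mulV A.transpose y))
  rw [e] at h1
  have h2 := mul_le_mul_of_nonneg_left (h (mulV A.transpose y)) (norm_nonneg y)
  rcases (norm_nonneg (mulV A.transpose y)).eq_or_lt with h0 | h0
  · rw [← h0]; positivity
  · refine le_of_mul_le_mul_right ?_ h0
    linarith

end QuadraticForms

namespace Problem

variable {nx nu np nw ny r : ℕ} {P : Problem nx nu np nw ny r}

/-! ### Stage cost and its relaxed continuity -/

section StageCost

theorem continuous_stageCost (P : Problem nx nu np nw ny r) : Continuous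
    (fun z : Vec nx × Vec nu × Vec nx × Vec nu => P.stageCost z.1 z.2.1 z.2.2.1 z.2.2.2) := by
  unfold stageCost
  have hQ := continuous_wsq P.Q
  have hR := continuous_wsq P.R
  fun_prop

theorem PositiveWeights.soft_nonneg (hw : P.PositiveWeights) (x : Vec nx) :
    0 ≤ ∑ i, P.q i * (max (inner ℝ (P.D i) x - P.d i) 0) ^ 2 :=
  Finset.sum_nonneg fun i _ => mul_nonneg (hw.q i).le (sq_nonneg _)

theorem PositiveWeights.wsqQ_le_stageCost (hw : P.PositiveWeights) (x : Vec nx) (u : Vec nu)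
    (xs : Vec nx) (us : Vec nu) : wsq P.Q (x - xs) ≤ P.stageCost x u xs us := by
  have := hw.soft_nonneg x
  have := wsq_nonneg hw.R.posSemidef (u - us)
  unfold stageCost; linarith

theorem PositiveWeights.wsqR_le_stageCost (hw : P.PositiveWeights) (x : Vec nx) (u : Vec nu)
    (xs : Vec nx) (us : Vec nu) : wsq P.R (u - us) ≤ P.stageCost x u xs us := by
  have := hw.soft_nonneg x
  have := wsq_nonneg hw.Q.posSemidef (x - xs)
  unfold stageCost; linarith

theorem PositiveWeights.stageCost_nonneg (hw : P.PositiveWeights) (x : Vec nx) (u : Vec nu)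
    (xs : Vec nx) (us : Vec nu) : 0 ≤ P.stageCost x u xs us :=
  (wsq_nonneg hw.Q.posSemidef _).trans (hw.wsqQ_le_stageCost x u xs us)

theorem stageCost_self {xs : Vec nx} (hxs : xs ∈ P.X) (us : Vec nu) :
    P.stageCost xs us xs us = 0 := by
  have : ∀ i, max (inner ℝ (P.D i) xs - P.d i) 0 = 0 := fun i =>
    max_eq_right (by linarith [hxs i])
  simp [stageCost, this, wsq]

theorem add_sq_le_weighted {ε : ℝ} (hε : 0 < ε) (a b : ℝ) :
    (a + b) ^ 2 ≤ (1 + ε) * a ^ 2 + (1 + ε⁻¹) * b ^ 2 := by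
  have h : 0 ≤ ε⁻¹ * (ε * a - b) ^ 2 := by positivity
  have e : ε⁻¹ * (ε * a - b) ^ 2 = ε * a ^ 2 - 2 * a * b + ε⁻¹ * b ^ 2 := by field_simp; ring
  rw [e] at h; linarith

theorem max_add_zero_le (a b : ℝ) : max (a + b) 0 ≤ max a 0 + |b| :=
  max_le (add_le_add (le_max_left _ _) (le_abs_self _)) (by positivity)

/-- The stage cost is relaxed-continuous: a perturbation of its arguments costs a factor
close to one and a quadratic term. -/
theorem PositiveWeights.exists_stageCost_le (hw : P.PositiveWeights) {ε : ℝ} (hε : 0 < ε) :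
    ∃ C : ℝ, 0 < C ∧ ∀ (x x' xs xs' : Vec nx) (u u' us us' : Vec nu),
      P.stageCost x' u' xs' us' ≤ (1 + ε) * P.stageCost x u xs us
        + C * (‖x' - x‖ + ‖u' - u‖ + ‖xs' - xs‖ + ‖us' - us‖) ^ 2 := by
  obtain ⟨CQ, hCQ, hQ⟩ := exists_wsq_le P.Q
  obtain ⟨CR, hCR, hR⟩ := exists_wsq_le P.R
  have hD : 0 ≤ ∑ i, P.q i * ‖P.D i‖ ^ 2 :=
    Finset.sum_nonneg fun i _ => mul_nonneg (hw.q i).le (sq_nonneg _)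
  -- Young's inequality with the same `ε` is applied to the state term, the input term and each soft
  -- constraint.
  refine ⟨(1 + ε⁻¹) * (CQ + CR + ∑ i, P.q i * ‖P.D i‖ ^ 2), by positivity, ?_⟩
  intro x x' xs xs' u u' us us'
  set E := ‖x' - x‖ + ‖u' - u‖ + ‖xs' - xs‖ + ‖us' - us‖ with hE
  have hε' : 0 ≤ 1 + ε⁻¹ := by positivity
  have h1 : wsq P.Q (x' - xs') ≤ (1 + ε) * wsq P.Q (x - xs) + (1 + ε⁻¹) * (CQ * E ^ 2) := by
    have e : x' - xs' = (x - xs) + ((x' - x) - (xs' - xs)) := by abel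
    rw [e]
    refine (wsq_add_le hw.Q.posSemidef hε _ _).trans ?_
    have hn : ‖(x' - x) - (xs' - xs)‖ ≤ E := (norm_sub_le _ _).trans (by
      rw [hE]; linarith [norm_nonneg (u' - u), norm_nonneg (us' - us)])
    gcongr
    exact (hQ _).trans (by gcongr)
  have h2 : wsq P.R (u' - us') ≤ (1 + ε) * wsq P.R (u - us) + (1 + ε⁻¹) * (CR * E ^ 2) := by
    have e : u' - us' = (u - us) + ((u' - u) - (us' - us)) := by abel
    rw [e]
    refine (wsq_add_le hw.R.posSemidef hε _ _).trans ?_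
    have hn : ‖(u' - u) - (us' - us)‖ ≤ E := (norm_sub_le _ _).trans (by
      rw [hE]; linarith [norm_nonneg (x' - x), norm_nonneg (xs' - xs)])
    gcongr
    exact (hR _).trans (by gcongr)
  have h3 : ∀ i, P.q i * (max (inner ℝ (P.D i) x' - P.d i) 0) ^ 2
      ≤ (1 + ε) * (P.q i * (max (inner ℝ (P.D i) x - P.d i) 0) ^ 2)
        + (1 + ε⁻¹) * ((P.q i * ‖P.D i‖ ^ 2) * E ^ 2) := by
    intro i
    have hq := (hw.q i).le
    have e : inner ℝ (P.D i) x' - P.d i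
        = (inner ℝ (P.D i) x - P.d i) + inner ℝ (P.D i) (x' - x) := by
      rw [inner_sub_right]; ring
    have ha : max (inner ℝ (P.D i) x' - P.d i) 0
        ≤ max (inner ℝ (P.D i) x - P.d i) 0 + ‖P.D i‖ * E := by
      rw [e]
      refine (max_add_zero_le _ _).trans ?_
      gcongr
      refine (abs_real_inner_le_norm _ _).trans ?_
      gcongr
      rw [hE]
      linarith [norm_nonneg (u' - u), norm_nonneg (us' - us), norm_nonneg (xs' - xs)]
    have hb := (pow_le_pow_left₀ (le_max_right _ _) ha 2).trans (add_sq_le_weighted hε _ _)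
    calc _ ≤ P.q i * ((1 + ε) * (max (inner ℝ (P.D i) x - P.d i) 0) ^ 2
          + (1 + ε⁻¹) * (‖P.D i‖ * E) ^ 2) := by gcongr
      _ = _ := by ring
  have h4 := Finset.sum_le_sum fun i (_ : i ∈ Finset.univ) => h3 i
  rw [Finset.sum_add_distrib, ← Finset.mul_sum, ← Finset.mul_sum, ← Finset.sum_mul] at h4
  unfold stageCost
  linarith

theorem PositiveWeights.exists_stageCost_le_norm_sq (hw : P.PositiveWeights) :
    ∃ C : ℝ, 0 < C ∧ ∀ xs ∈ P.X, ∀ (x : Vec nx) (us : Vec nu),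
      P.stageCost x us xs us ≤ C * ‖x - xs‖ ^ 2 := by
  obtain ⟨C, hC, h⟩ := hw.exists_stageCost_le one_pos
  refine ⟨C, hC, fun xs hxs x us => ?_⟩
  simpa [stageCost_self hxs] using h xs x xs xs us us us us

end StageCost

/-! ### Nominal trajectories -/

section Trajectories

theorem traj_congr {u u' : ℕ → Vec nu} {k : ℕ} (h : ∀ j < k, u j = u' j) (x : Vec nx)
    (θ : Vec np) : P.traj u x θ k = P.traj u' x θ k := by
  induction k with
  | zero => rfl
  | succ k ih => rw [traj, traj, ih fun j hj => h j (by omega), h k (by omega)]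

theorem traj_add (u : ℕ → Vec nu) (x : Vec nx) (θ : Vec np) (a b : ℕ) :
    P.traj u x θ (a + b) = P.traj (fun j => u (a + j)) (P.traj u x θ a) θ b := by
  induction b with
  | zero => rfl
  | succ b ih => rw [← add_assoc, traj, traj, ih]

theorem traj_succ' (u : ℕ → Vec nu) (x : Vec nx) (θ : Vec np) (k : ℕ) :
    P.traj u x θ (k + 1) = P.traj (fun j => u (j + 1)) (P.f x (u 0) θ 0) θ k := by
  rw [add_comm, traj_add]
  simp only [add_comm 1]
  rfl

theorem Regular.exists_lipschitz_f (hr : P.Regular) : ∃ L : ℝ, 1 ≤ L ∧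
    ∀ x x' : Vec nx, ∀ u ∈ P.U, ∀ u' ∈ P.U, ∀ θ ∈ P.Θ, ∀ θ' ∈ P.Θ, ∀ w w' : Vec nw,
      ‖P.f x u θ w - P.f x' u' θ' w'‖
        ≤ L * (‖x - x'‖ + ‖u - u'‖ + ‖θ - θ'‖ + ‖w - w'‖) := by
  obtain ⟨L, hL⟩ := hr.lipschitz_f
  refine ⟨max L 1, le_max_right _ _, fun x x' u hu u' hu' θ hθ θ' hθ' w w' => ?_⟩
  exact (hL x x' u hu u' hu' θ hθ θ' hθ' w w').trans
    (mul_le_mul_of_nonneg_right (le_max_left _ _) (by positivity))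

theorem Regular.exists_lipschitz_h (hr : P.Regular) : ∃ L : ℝ, 1 ≤ L ∧
    ∀ x x' : Vec nx, ∀ u ∈ P.U, ∀ u' ∈ P.U, ∀ θ ∈ P.Θ, ∀ θ' ∈ P.Θ,
      ‖P.h x u θ - P.h x' u' θ'‖ ≤ L * (‖x - x'‖ + ‖u - u'‖ + ‖θ - θ'‖) := by
  obtain ⟨L, hL⟩ := hr.lipschitz_h
  refine ⟨max L 1, le_max_right _ _, fun x x' u hu u' hu' θ hθ θ' hθ' => ?_⟩
  exact (hL x x' u hu u' hu' θ hθ θ' hθ').trans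
    (mul_le_mul_of_nonneg_right (le_max_left _ _) (by positivity))

theorem Regular.exists_lipschitz_traj (hr : P.Regular) (k : ℕ) : ∃ a : ℝ, 0 ≤ a ∧
    ∀ (u u' : ℕ → Vec nu), (∀ j, u j ∈ P.U) → (∀ j, u' j ∈ P.U) → ∀ (x x' : Vec nx),
      ∀ θ ∈ P.Θ, ∀ θ' ∈ P.Θ, ∀ e : ℝ, (∀ j, ‖u' j - u j‖ ≤ e) →
        ‖P.traj u' x' θ' k - P.traj u x θ k‖ ≤ a * (‖x' - x‖ + ‖θ' - θ‖ + e) := by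
  obtain ⟨L, hL1, hL⟩ := hr.exists_lipschitz_f
  induction k with
  | zero =>
    refine ⟨1, zero_le_one, fun u u' _ _ x x' θ _ θ' _ e he => ?_⟩
    have := (norm_nonneg _).trans (he 0)
    simp only [traj]
    linarith [norm_nonneg (θ' - θ)]
  | succ k ih =>
    obtain ⟨a, ha, h⟩ := ih
    refine ⟨L * (a + 1), by positivity, fun u u' hu hu' x x' θ hθ θ' hθ' e he => ?_⟩
    have h1 := h u u' hu hu' x x' θ hθ θ' hθ' e he
    have h2 := hL (P.traj u' x' θ' k) (P.traj u x θ k) _ (hu' k) _ (hu k) θ' hθ' θ hθ 0 0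
    simp only [traj]
    refine h2.trans ?_
    rw [mul_assoc]
    gcongr
    simp only [sub_zero, norm_zero, add_zero]
    linarith [he k, norm_nonneg (x' - x)]

theorem Regular.continuous_f (hr : P.Regular) (θ : Vec np) :
    Continuous fun z : Vec nx × Vec nu => P.f z.1 z.2 θ 0 :=
  hr.contDiff_f.continuous.comp
    (f := fun z : Vec nx × Vec nu => (z.1, z.2, θ, (0 : Vec nw))) (by fun_prop)

theorem Regular.continuous_traj (hr : P.Regular) {Z : Type*} [TopologicalSpace Z]
    {x : Z → Vec nx} {u : Z → ℕ → Vec nu} (hx : Continuous x)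
    (hu : ∀ k, Continuous fun z => u z k) (θ : Vec np) (k : ℕ) :
    Continuous fun z => P.traj (u z) (x z) θ k := by
  induction k with
  | zero => exact hx
  | succ k ih => exact (hr.continuous_f θ).comp (ih.prodMk (hu k))

end Trajectories

/-! ### Cost of infinite input sequences -/

section SequenceCost

/-- The finite-horizon cost of an infinite input sequence. -/
noncomputable def seqCost (P : Problem nx nu np nw ny r) (N M : ℕ) (ω : ℝ) (x : Vec nx)
    (θ : Vec np) (u : ℕ → Vec nu) (xs : Vec nx) (us : Vec nu) : ℝ :=
  (∑ k ∈ Finset.range N, P.stageCost (P.traj u x θ k) (u k) xs us)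
    + ω * P.tailCost M (P.traj u x θ N) xs us θ

/-- Inputs beyond the horizon do not enter the cost, so candidates may be shifted and concatenated
as sequences on `ℕ`. -/
theorem seqCost_eq_horizonCost (N M : ℕ) (ω : ℝ) (x : Vec nx) (θ : Vec np) (u : ℕ → Vec nu)
    (xs : Vec nx) (us : Vec nu) :
    P.seqCost N M ω x θ u xs us = P.horizonCost N M ω x θ (fun k : Fin N => u k) xs us := by
  have h : ∀ k ≤ N, P.traj (extend fun k : Fin N => u k) x θ k = P.traj u x θ k := fun k hk =>
    traj_congr (fun j hj => by simp [extend, show j < N by omega]) x θ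
  rw [seqCost, horizonCost, h N le_rfl, Finset.sum_range]
  congr 1
  exact Finset.sum_congr rfl fun k _ => by rw [h k k.2.le]

theorem seqCost_add (a b M : ℕ) (ω : ℝ) (x : Vec nx) (θ : Vec np) (u : ℕ → Vec nu)
    (xs : Vec nx) (us : Vec nu) :
    P.seqCost (a + b) M ω x θ u xs us
      = (∑ k ∈ Finset.range a, P.stageCost (P.traj u x θ k) (u k) xs us)
        + P.seqCost b M ω (P.traj u x θ a) θ (fun j => u (a + j)) xs us := by
  simp only [seqCost, Finset.sum_range_add, traj_add]
  ring

theorem PositiveWeights.tailCost_nonneg (hw : P.PositiveWeights) (M : ℕ) (x xs : Vec nx)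
    (us : Vec nu) (θ : Vec np) : 0 ≤ P.tailCost M x xs us θ :=
  Finset.sum_nonneg fun _ _ => hw.stageCost_nonneg _ _ _ _

theorem PositiveWeights.sum_stageCost_le_seqCost (hw : P.PositiveWeights) {a N : ℕ} (h : a ≤ N)
    (M : ℕ) {ω : ℝ} (hω : 0 ≤ ω) (x : Vec nx) (θ : Vec np) (u : ℕ → Vec nu)
    (xs : Vec nx) (us : Vec nu) :
    ∑ k ∈ Finset.range a, P.stageCost (P.traj u x θ k) (u k) xs us
      ≤ P.seqCost N M ω x θ u xs us := by
  refine le_add_of_le_of_nonneg ?_ (mul_nonneg hω (hw.tailCost_nonneg _ _ _ _ _))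
  exact Finset.sum_le_sum_of_subset_of_nonneg (by simpa using h)
    fun _ _ _ => hw.stageCost_nonneg _ _ _ _

/-- The cost of keeping the steady-state input is bounded by the squared distance to the
steady state, uniformly in the horizons. -/
theorem exists_seqCost_const_le (hw : P.PositiveWeights) (hs : P.OpenLoopStable) :
    ∃ κ : ℝ, 0 < κ ∧ ∀ (N M : ℕ) (ω : ℝ), 0 ≤ ω → ∀ θ ∈ P.Θ, ∀ s ∈ P.S θ, ∀ x : Vec nx,
      P.seqCost N M ω x θ (fun _ => s.2.1) s.1 s.2.1 ≤ κ * (1 + ω) * ‖x - s.1‖ ^ 2 := by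
  obtain ⟨C, hC, hcost⟩ := hw.exists_stageCost_le_norm_sq
  obtain ⟨Cρ, ρ, hCρ, hρ0, hρ1, hstab⟩ := hs
  have hρ2 : ρ ^ 2 < 1 := by nlinarith
  have hgeo : ∀ n, ∑ k ∈ Finset.range n, (ρ ^ 2) ^ k ≤ (1 - ρ ^ 2)⁻¹ := fun n => by
    rw [← tsum_geometric_of_lt_one (sq_nonneg ρ) hρ2]
    exact (summable_geometric_of_lt_one (sq_nonneg ρ) hρ2).sum_le_tsum _
      fun _ _ => by positivity
  have hpos : 0 < 1 - ρ ^ 2 := by linarith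
  have hsum : ∀ n, ∀ θ ∈ P.Θ, ∀ s ∈ P.S θ, ∀ x : Vec nx,
      ∑ k ∈ Finset.range n, P.stageCost (P.traj (fun _ => s.2.1) x θ k) s.2.1 s.1 s.2.1
        ≤ C * Cρ ^ 2 * (1 - ρ ^ 2)⁻¹ * ‖x - s.1‖ ^ 2 := by
    intro n θ hθ s hs x
    have h1 : ∀ k ∈ Finset.range n,
        P.stageCost (P.traj (fun _ => s.2.1) x θ k) s.2.1 s.1 s.2.1
          ≤ C * Cρ ^ 2 * ‖x - s.1‖ ^ 2 * (ρ ^ 2) ^ k := by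
      intro k _
      refine (hcost _ hs.1 _ _).trans ?_
      have h2 := pow_le_pow_left₀ (norm_nonneg _) (hstab θ hθ s.1 s.2.1 hs.2.1 hs.2.2.1 x k) 2
      calc _ ≤ C * (Cρ * ρ ^ k * ‖x - s.1‖) ^ 2 := by gcongr
        _ = _ := by ring
    refine (Finset.sum_le_sum h1).trans ?_
    rw [← Finset.mul_sum]
    calc _ ≤ C * Cρ ^ 2 * ‖x - s.1‖ ^ 2 * (1 - ρ ^ 2)⁻¹ := by
          gcongr; exact hgeo n
      _ = _ := by ring
  -- The second factor `Cρ ^ 2` pays for the terminal rollout, which starts at time `N`.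
  refine ⟨C * Cρ ^ 2 * (1 - ρ ^ 2)⁻¹ * Cρ ^ 2, by positivity, ?_⟩
  intro N M ω hω θ hθ s hs x
  have h1 := hsum N θ hθ s hs x
  have h2 := hsum M θ hθ s hs (P.traj (fun _ => s.2.1) x θ N)
  have h3 : ‖P.traj (fun _ => s.2.1) x θ N - s.1‖ ≤ Cρ * ‖x - s.1‖ := by
    refine (hstab θ hθ s.1 s.2.1 hs.2.1 hs.2.2.1 x N).trans ?_
    gcongr
    exact mul_le_of_le_one_right (by linarith) (pow_le_one₀ hρ0.le hρ1.le)
  set A := C * Cρ ^ 2 * (1 - ρ ^ 2)⁻¹ with hA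
  have hA0 : 0 < A := by positivity
  have h4 : A * ‖x - s.1‖ ^ 2 ≤ A * Cρ ^ 2 * ‖x - s.1‖ ^ 2 := by
    gcongr; exact le_mul_of_one_le_right hA0.le (one_le_pow₀ hCρ)
  have h5 : P.tailCost M (P.traj (fun _ => s.2.1) x θ N) s.1 s.2.1 θ
      ≤ A * Cρ ^ 2 * ‖x - s.1‖ ^ 2 := by
    refine h2.trans ?_
    calc _ ≤ A * (Cρ * ‖x - s.1‖) ^ 2 := by gcongr
      _ = _ := by ring
  have h6 := mul_le_mul_of_nonneg_left h5 hω
  unfold seqCost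
  linarith

/-- Relaxed continuity passes from the stage cost to the whole cost because predictions over a fixed
number of steps are Lipschitz in initial state, parameter and input. -/
theorem PositiveWeights.exists_seqCost_le (hw : P.PositiveWeights) (hr : P.Regular) (N M : ℕ)
    {ω : ℝ} (hω : 0 ≤ ω) {ε : ℝ} (hε : 0 < ε) :
    ∃ C : ℝ, 0 < C ∧ ∀ (u : ℕ → Vec nu), (∀ j, u j ∈ P.U) → ∀ us ∈ P.U, ∀ us' ∈ P.U,
      ∀ θ ∈ P.Θ, ∀ θ' ∈ P.Θ, ∀ x x' xs xs' : Vec nx,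
      P.seqCost N M ω x' θ' u xs' us' ≤ (1 + ε) * P.seqCost N M ω x θ u xs us
        + C * (‖x' - x‖ + ‖θ' - θ‖ + ‖xs' - xs‖ + ‖us' - us‖) ^ 2 := by
  obtain ⟨C, hC, hcost⟩ := hw.exists_stageCost_le hε
  choose a ha hlip using hr.exists_lipschitz_traj
  -- In the terminal sum `us` also drives the rollout and is itself the stage input, hence the
  -- larger constants. The last `1` keeps the constant positive when the sums vanish.
  refine ⟨∑ k ∈ Finset.range N, C * (a k + 1) ^ 2
      + ω * ∑ k ∈ Finset.range M, C * (a k * (a N + 2) + 2) ^ 2 + 1, ?_, ?_⟩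
  · have h1 : 0 ≤ ∑ k ∈ Finset.range N, C * (a k + 1) ^ 2 :=
      Finset.sum_nonneg fun _ _ => by positivity
    have h2 : 0 ≤ ∑ k ∈ Finset.range M, C * (a k * (a N + 2) + 2) ^ 2 :=
      Finset.sum_nonneg fun _ _ => by positivity
    positivity
  intro u hu us hus us' hus' θ hθ θ' hθ' x x' xs xs'
  set E := ‖x' - x‖ + ‖θ' - θ‖ + ‖xs' - xs‖ + ‖us' - us‖ with hE
  have n1 := norm_nonneg (x' - x)
  have n2 := norm_nonneg (θ' - θ)
  have n3 := norm_nonneg (xs' - xs)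
  have n4 := norm_nonneg (us' - us)
  have hE0 : 0 ≤ E := by positivity
  have htr : ∀ k, ‖P.traj u x' θ' k - P.traj u x θ k‖ ≤ a k * E := fun k => by
    refine (hlip k u u hu hu x x' θ hθ θ' hθ' 0 (by simp)).trans ?_
    refine mul_le_mul_of_nonneg_left ?_ (ha k)
    linarith
  have htail : ∀ k, ‖P.traj (fun _ => us') (P.traj u x' θ' N) θ' k
      - P.traj (fun _ => us) (P.traj u x θ N) θ k‖ ≤ a k * (a N + 2) * E := fun k => by
    refine (hlip k (fun _ => us) (fun _ => us') (fun _ => hus) (fun _ => hus') (P.traj u x θ N)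
      (P.traj u x' θ' N) θ hθ θ' hθ' ‖us' - us‖ (fun _ => le_rfl)).trans ?_
    rw [mul_assoc]
    refine mul_le_mul_of_nonneg_left ?_ (ha k)
    linarith [htr N]
  have h1 : ∀ k ∈ Finset.range N, P.stageCost (P.traj u x' θ' k) (u k) xs' us'
      ≤ (1 + ε) * P.stageCost (P.traj u x θ k) (u k) xs us + C * (a k + 1) ^ 2 * E ^ 2 := by
    intro k _
    refine (hcost (P.traj u x θ k) _ xs _ (u k) _ us _).trans ?_
    rw [mul_assoc C, ← mul_pow]
    have : 0 ≤ ‖P.traj u x' θ' k - P.traj u x θ k‖ + ‖u k - u k‖ + ‖xs' - xs‖ + ‖us' - us‖ := by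
      positivity
    gcongr
    simp only [sub_self, norm_zero, add_zero]
    linarith [htr k]
  have h2 : ∀ k ∈ Finset.range M,
      P.stageCost (P.traj (fun _ => us') (P.traj u x' θ' N) θ' k) us' xs' us'
      ≤ (1 + ε) * P.stageCost (P.traj (fun _ => us) (P.traj u x θ N) θ k) us xs us
        + C * (a k * (a N + 2) + 2) ^ 2 * E ^ 2 := by
    intro k _
    refine (hcost (P.traj (fun _ => us) (P.traj u x θ N) θ k) _ xs _ us _ us _).trans ?_
    rw [mul_assoc C, ← mul_pow]
    have := norm_nonneg (P.traj (fun _ => us') (P.traj u x' θ' N) θ' k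
      - P.traj (fun _ => us) (P.traj u x θ N) θ k)
    gcongr
    linarith [htail k]
  have h3 := Finset.sum_le_sum h1
  have h4 := mul_le_mul_of_nonneg_left (Finset.sum_le_sum h2) hω
  rw [Finset.sum_add_distrib, ← Finset.mul_sum, ← Finset.sum_mul] at h3 h4
  have h5 := sq_nonneg E
  unfold seqCost tailCost
  linarith

end SequenceCost

/-! ### Existence of minimizers and comparison with candidates -/

section Minimizers

theorem Regular.isCompact_S (hr : P.Regular) {θ : Vec np} (hθ : θ ∈ P.Θ) :
    IsCompact (P.S θ) := by
  obtain ⟨B, hB⟩ := hr.bounded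
  refine Metric.isCompact_of_isClosed_isBounded (hr.closed θ hθ) ?_
  exact isBounded_iff_forall_norm_le.2 ⟨B, hB θ hθ⟩

theorem Regular.continuous_mpcCost (hr : P.Regular) (N M : ℕ) (ω : ℝ) (x : Vec nx)
    (θ : Vec np) : Continuous fun z : (Fin N → Vec nu) × (Vec nx × Vec nu × Vec ny) =>
      P.mpcCost N M ω x θ z.1 z.2 := by
  have hext : ∀ k, Continuous fun z : (Fin N → Vec nu) × (Vec nx × Vec nu × Vec ny) =>
      extend z.1 k := by
    intro k
    by_cases hk : k < N
    · simp only [extend, hk, dif_pos]; fun_prop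
    · simp only [extend, hk, dif_neg, not_false_eq_true]; fun_prop
  have htr := hr.continuous_traj
    (continuous_const (y := x) (X := (Fin N → Vec nu) × (Vec nx × Vec nu × Vec ny))) hext θ
  have htail := fun k => hr.continuous_traj (htr N)
    (u := fun z : (Fin N → Vec nu) × (Vec nx × Vec nu × Vec ny) => fun _ : ℕ => z.2.2.1)
    (fun _ => by fun_prop) θ k
  have hcost : ∀ {x : (Fin N → Vec nu) × (Vec nx × Vec nu × Vec ny) → Vec nx}
      {u : (Fin N → Vec nu) × (Vec nx × Vec nu × Vec ny) → Vec nu}, Continuous x →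
      Continuous u → Continuous fun z => P.stageCost (x z) (u z) z.2.1 z.2.2.1 := by
    intro x u hx hu
    exact P.continuous_stageCost.comp (hx.prodMk (hu.prodMk
      ((continuous_fst.comp continuous_snd).prodMk
        (continuous_fst.comp (continuous_snd.comp continuous_snd)))))
  have hT := continuous_wsq P.T
  unfold mpcCost horizonCost tailCost
  refine Continuous.add (Continuous.add ?_ ?_) (by fun_prop)
  · exact continuous_finsetSum _ fun k _ => hcost (htr k) (by fun_prop)
  · exact continuous_const.mul (continuous_finsetSum _ fun k _ =>
      hcost (htail k) (by fun_prop))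

theorem Regular.exists_isMPCMinimizer (hr : P.Regular) (N M : ℕ) (ω : ℝ) (x : Vec nx)
    {θ : Vec np} (hθ : θ ∈ P.Θ) : ∃ ū s, P.IsMPCMinimizer N M ω x θ ū s := by
  obtain ⟨s₀, hs₀⟩ := hr.nonempty θ hθ
  have hcomp : IsCompact ((Set.univ.pi fun _ : Fin N => P.U) ×ˢ P.S θ) :=
    (isCompact_univ_pi fun _ => hr.compact_U).prod (hr.isCompact_S hθ)
  obtain ⟨z, hz, hmin⟩ := hcomp.exists_isMinOn
    ⟨(fun _ => s₀.2.1, s₀), fun _ _ => hs₀.2.1, hs₀⟩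
    (hr.continuous_mpcCost N M ω x θ).continuousOn
  exact ⟨z.1, z.2, fun k => hz.1 k trivial, hz.2, fun ū' hū' s' hs' =>
    isMinOn_iff.1 hmin (ū', s') ⟨fun k _ => hū' k, hs'⟩⟩

theorem Regular.nonempty_mpcLaw (hr : P.Regular) (N M : ℕ) (ω : ℝ) :
    Nonempty (P.MPCLaw N M ω) := by
  have h : ∀ x θ, ∃ z : (Fin N → Vec nu) × (Vec nx × Vec nu × Vec ny),
      θ ∈ P.Θ → P.IsMPCMinimizer N M ω x θ z.1 z.2 := by
    intro x θ
    by_cases hθ : θ ∈ P.Θ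
    · obtain ⟨ū, s, h⟩ := hr.exists_isMPCMinimizer N M ω x hθ
      exact ⟨(ū, s), fun _ => h⟩
    -- Outside `P.Θ` nothing is required, so any value serves.
    · exact ⟨0, fun h => absurd h hθ⟩
  choose z hz using h
  exact ⟨⟨fun x θ => (z x θ).1, fun x θ => (z x θ).2, hz⟩⟩

end Minimizers

namespace MPCLaw

variable {N M : ℕ} {ω : ℝ} (law : P.MPCLaw N M ω)

theorem setpoint_mem (x : Vec nx) {θ : Vec np} (hθ : θ ∈ P.Θ) : law.setpoint x θ ∈ P.S θ :=
  (law.isMin x θ hθ).2.1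

theorem value_le (x : Vec nx) {θ : Vec np} (hθ : θ ∈ P.Θ) {u : ℕ → Vec nu}
    (hu : ∀ j, u j ∈ P.U) {s : Vec nx × Vec nu × Vec ny} (hs : s ∈ P.S θ) :
    law.value x θ ≤ P.seqCost N M ω x θ u s.1 s.2.1 + wsq P.T (s.2.2 - P.yd) := by
  rw [seqCost_eq_horizonCost]
  exact (law.isMin x θ hθ).2.2 (fun k => u k) (fun k => hu k) s hs

/-- The minimizing inputs, continued by admissible inputs. -/
theorem exists_inputs (hN : 1 ≤ N) (x : Vec nx) {θ : Vec np} (hθ : θ ∈ P.Θ) :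
    ∃ u : ℕ → Vec nu, (∀ j, u j ∈ P.U) ∧ u 0 = law.policy x θ ∧
      law.value x θ = P.seqCost N M ω x θ u (law.setpoint x θ).1 (law.setpoint x θ).2.1
        + wsq P.T ((law.setpoint x θ).2.2 - P.yd) := by
  refine ⟨fun j => if hj : j < N then law.inputs x θ ⟨j, hj⟩ else (law.setpoint x θ).2.1,
    fun j => ?_, ?_, ?_⟩
  · dsimp only
    split_ifs with hj
    · exact (law.isMin x θ hθ).1 _
    · exact (law.setpoint_mem x hθ).2.1
  · simp [policy, extend, show 0 < N from hN]
  · rw [seqCost_eq_horizonCost]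
    simp [value, mpcCost]

theorem policy_mem (hN : 1 ≤ N) (x : Vec nx) {θ : Vec np} (hθ : θ ∈ P.Θ) :
    law.policy x θ ∈ P.U := by
  obtain ⟨u, hu, h0, _⟩ := law.exists_inputs hN x hθ
  exact h0 ▸ hu 0

end MPCLaw

/-! ### Nominal decrease -/

section NominalDecrease

/-- The switching time `m` stays free: the long-horizon argument picks a cheap time, the
terminal-weight argument takes `m = N - 1`. -/
theorem seqCost_shift {N m : ℕ} (hm : m ≤ N) (M : ℕ) (ω : ℝ) (x : Vec nx)
    (θ : Vec np) (u : ℕ → Vec nu) (xs : Vec nx) (us : Vec nu) :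
    P.seqCost N M ω (P.f x (u 0) θ 0) θ (fun j => if j < m then u (j + 1) else us) xs us
      = (∑ k ∈ Finset.range m, P.stageCost (P.traj u x θ (k + 1)) (u (k + 1)) xs us)
        + P.seqCost (N - m) M ω (P.traj u x θ (m + 1)) θ (fun _ => us) xs us := by
  obtain ⟨b, rfl⟩ := Nat.exists_eq_add_of_le hm
  have h : ∀ k ≤ m, P.traj (fun j => if j < m then u (j + 1) else us) (P.f x (u 0) θ 0) θ k
      = P.traj u x θ (k + 1) := fun k hk => by
    rw [traj_succ']
    exact traj_congr (fun j hj => by simp [show j < m by omega]) _ _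
  rw [seqCost_add, h m le_rfl]
  congr 1
  · refine Finset.sum_congr rfl fun k hk => ?_
    have hk := Finset.mem_range.1 hk
    rw [h k hk.le, if_pos hk]
  · simp

/-- The shifted input sequence, continued from time `m` on by the steady-state input. -/
theorem MPCLaw.exists_value_succ_le {N M : ℕ} {ω : ℝ} (law : P.MPCLaw N M ω) (hN : 1 ≤ N)
    (x : Vec nx) {θ : Vec np} (hθ : θ ∈ P.Θ) :
    ∃ u : ℕ → Vec nu, u 0 = law.policy x θ ∧
      law.value x θ = P.seqCost N M ω x θ u (law.setpoint x θ).1 (law.setpoint x θ).2.1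
        + wsq P.T ((law.setpoint x θ).2.2 - P.yd) ∧
      ∀ m ≤ N, law.value (P.f x (law.policy x θ) θ 0) θ
        ≤ (∑ k ∈ Finset.range m, P.stageCost (P.traj u x θ (k + 1)) (u (k + 1))
            (law.setpoint x θ).1 (law.setpoint x θ).2.1)
          + P.seqCost (N - m) M ω (P.traj u x θ (m + 1)) θ (fun _ => (law.setpoint x θ).2.1)
            (law.setpoint x θ).1 (law.setpoint x θ).2.1
          + wsq P.T ((law.setpoint x θ).2.2 - P.yd) := by
  obtain ⟨u, hu, h0, hval⟩ := law.exists_inputs hN x hθ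
  have hs := law.setpoint_mem x hθ
  refine ⟨u, h0, hval, fun m hm => ?_⟩
  rw [← seqCost_shift hm, ← h0]
  refine law.value_le _ hθ (fun j => ?_) hs
  split_ifs
  · exact hu _
  · exact hs.2.1

/-- Exponential stability bounds the optimal tracking cost by a multiple of `ℓ 0` independent of
`N`. In a long horizon some predicted state is thus so close to the setpoint that finishing with the
constant input costs at most half of `ℓ 0`, while the shift saves `ℓ 0`. -/
theorem exists_horizon_nominalDecrease (hw : P.PositiveWeights) (hs : P.OpenLoopStable)
    {ω : ℝ} (hω : 0 ≤ ω) (M : ℕ) : ∃ N : ℕ, 1 ≤ N ∧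
      ∀ law : P.MPCLaw N M ω, law.NominalDecrease (1 / 2) := by
  obtain ⟨κ₀, hκ₀, hκ⟩ := exists_seqCost_const_le hw hs
  obtain ⟨c, hc, hQ⟩ := exists_norm_sq_le_wsq hw.Q
  set κ := κ₀ * (1 + ω) with hκdef
  have hκpos : 0 < κ := by positivity
  -- This makes the switching cost `κ² c² / n * ℓ 0` at most `ℓ 0 / 2`.
  obtain ⟨n, hn⟩ := exists_nat_gt (2 * (κ * κ * c * c))
  have hn0 : (0 : ℝ) < n := lt_of_le_of_lt (by positivity) hn
  refine ⟨n + 1, by omega, fun law x θ hθ => ?_⟩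
  obtain ⟨u, h0, hval, hnext⟩ := law.exists_value_succ_le (by omega) x hθ
  have hmem := law.setpoint_mem x hθ
  set s := law.setpoint x θ
  set ℓ := fun k => P.stageCost (P.traj u x θ k) (u k) s.1 s.2.1 with hℓ
  have hℓ0 : ∀ k, ‖P.traj u x θ k - s.1‖ ^ 2 ≤ c * ℓ k := fun k =>
    (hQ _).trans (mul_le_mul_of_nonneg_left (hw.wsqQ_le_stageCost _ _ _ _) hc.le)
  -- The comparison keeps the optimal setpoint, so the offset cost cancels.
  have hupper : P.seqCost (n + 1) M ω x θ u s.1 s.2.1 ≤ κ * ‖x - s.1‖ ^ 2 := by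
    have h1 := law.value_le x hθ (fun _ => hmem.2.1) hmem
    have h2 := hκ (n + 1) M ω hω θ hθ s hmem x
    linarith
  have hsum : ∑ k ∈ Finset.range (n + 1), ℓ k ≤ κ * (c * ℓ 0) :=
    (hw.sum_stageCost_le_seqCost le_rfl M hω x θ u s.1 s.2.1).trans
      (hupper.trans (mul_le_mul_of_nonneg_left (hℓ0 0) hκpos.le))
  have hℓnn : ∀ k, 0 ≤ ℓ k := fun k => hw.stageCost_nonneg _ _ _ _
  -- Some term is at most the average.
  obtain ⟨m, hm, hmle⟩ : ∃ m ∈ Finset.range n, ℓ (m + 1) ≤ κ * (c * ℓ 0) / n := by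
    refine Finset.exists_le_of_sum_le (by simpa using (Nat.cast_pos.1 hn0).ne') ?_
    rw [Finset.sum_const, Finset.card_range, nsmul_eq_mul, mul_div_cancel₀ _ hn0.ne']
    rw [Finset.sum_range_succ'] at hsum
    linarith [hℓnn 0]
  have hm := Finset.mem_range.1 hm
  have h1 := hnext m (by omega)
  have h2 := hκ (n + 1 - m) M ω hω θ hθ s hmem (P.traj u x θ (m + 1))
  have h3 := hw.sum_stageCost_le_seqCost (show m + 1 ≤ n + 1 by omega) M hω x θ u s.1 s.2.1
  rw [Finset.sum_range_succ'] at h3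
  have h4 : κ * ‖P.traj u x θ (m + 1) - s.1‖ ^ 2 ≤ 1 / 2 * ℓ 0 := by
    calc κ * ‖P.traj u x θ (m + 1) - s.1‖ ^ 2 ≤ κ * (c * (κ * (c * ℓ 0) / n)) := by
          refine mul_le_mul_of_nonneg_left ((hℓ0 _).trans ?_) hκpos.le
          exact mul_le_mul_of_nonneg_left hmle hc.le
      _ = (κ * κ * c * c) / n * ℓ 0 := by ring
      _ ≤ 1 / 2 * ℓ 0 := by
          refine mul_le_mul_of_nonneg_right ?_ (hℓnn 0)
          rw [div_le_iff₀ hn0]; linarith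
  have h5 : ℓ 0 = P.stageCost x (law.policy x θ) s.1 s.2.1 := by rw [hℓ, ← h0]; rfl
  simp only [hℓ] at h4 h5
  rw [← h5]
  linarith

/-- For large `M` the last stage of the rollout is at most `ε < 1` times its first. One step under
`us` then lowers the tail cost by at least `1 - ε` times the first stage, and `ω * (1 - ε) ≥ 1` pays
for the stage appended by the shift. -/
theorem exists_weight_nominalDecrease (hw : P.PositiveWeights) (hs : P.OpenLoopStable) :
    ∃ M₀ : ℕ, ∀ M : ℕ, M₀ ≤ M → ∃ ω₀ : ℝ, 1 ≤ ω₀ ∧ ∀ ω : ℝ, ω₀ < ω → ∀ N : ℕ, 1 ≤ N →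
      ∀ law : P.MPCLaw N M ω, law.NominalDecrease 1 := by
  obtain ⟨C, hC, hcost⟩ := hw.exists_stageCost_le_norm_sq
  obtain ⟨c, hc, hQ⟩ := exists_norm_sq_le_wsq hw.Q
  obtain ⟨Cρ, ρ, hCρ, hρ0, hρ1, hstab⟩ := hs
  have hlim : Filter.Tendsto (fun M : ℕ => C * Cρ ^ 2 * c * (ρ ^ 2) ^ M) Filter.atTop
      (nhds (C * Cρ ^ 2 * c * 0)) :=
    (tendsto_pow_atTop_nhds_zero_of_lt_one (sq_nonneg ρ) (by nlinarith)).const_mul _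
  rw [mul_zero] at hlim
  obtain ⟨M₀, hM₀⟩ := Filter.eventually_atTop.1 (hlim.eventually_lt_const one_pos)
  refine ⟨M₀, fun M hM => ?_⟩
  have hε1 := hM₀ M hM
  set ε := C * Cρ ^ 2 * c * (ρ ^ 2) ^ M with hε
  have hε0 : 0 < ε := by positivity
  refine ⟨(1 - ε)⁻¹, (one_le_inv₀ (by linarith)).2 (by linarith), fun ω hω N hN law x θ hθ => ?_⟩
  have hω1 : 1 ≤ ω * (1 - ε) := by
    have := mul_le_mul_of_nonneg_right hω.le (show 0 ≤ 1 - ε by linarith)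
    rwa [inv_mul_cancel₀ (by linarith)] at this
  have hω0 : 0 < ω := (inv_pos.2 (by linarith)).trans hω
  obtain ⟨u, h0, hval, hnext⟩ := law.exists_value_succ_le hN x hθ
  have hmem := law.setpoint_mem x hθ
  set s := law.setpoint x θ
  obtain ⟨n, rfl⟩ : ∃ n, N = n + 1 := ⟨N - 1, by omega⟩
  have h1 := hnext n (by omega)
  rw [show n + 1 - n = 1 by omega] at h1
  set z := P.traj u x θ (n + 1) with hz
  have h2 : P.seqCost 1 M ω z θ (fun _ => s.2.1) s.1 s.2.1
      ≤ ω * P.tailCost M z s.1 s.2.1 θ := by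
    -- The rollouts from `z` and from its successor share all but the first and the last stage.
    have e : P.tailCost M (P.traj (fun _ => s.2.1) z θ 1) s.1 s.2.1 θ
        + P.stageCost z s.2.1 s.1 s.2.1
        = P.tailCost M z s.1 s.2.1 θ
          + P.stageCost (P.traj (fun _ => s.2.1) z θ M) s.2.1 s.1 s.2.1 := by
      have e1 := Finset.sum_range_succ'
        (fun k => P.stageCost (P.traj (fun _ => s.2.1) z θ k) s.2.1 s.1 s.2.1) M
      rw [Finset.sum_range_succ] at e1
      simp only [traj_succ' (fun _ => s.2.1)] at e1
      exact e1.symm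
    have hlast : P.stageCost (P.traj (fun _ => s.2.1) z θ M) s.2.1 s.1 s.2.1
        ≤ ε * P.stageCost z s.2.1 s.1 s.2.1 := by
      refine (hcost _ hmem.1 _ _).trans ?_
      have h3 := pow_le_pow_left₀ (norm_nonneg _)
        (hstab θ hθ s.1 s.2.1 hmem.2.1 hmem.2.2.1 z M) 2
      have h4 := (hQ (z - s.1)).trans
        (mul_le_mul_of_nonneg_left (hw.wsqQ_le_stageCost z s.2.1 s.1 s.2.1) hc.le)
      calc _ ≤ C * (Cρ * ρ ^ M * ‖z - s.1‖) ^ 2 := by gcongr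
        _ = C * Cρ ^ 2 * (ρ ^ 2) ^ M * ‖z - s.1‖ ^ 2 := by ring
        _ ≤ C * Cρ ^ 2 * (ρ ^ 2) ^ M * (c * P.stageCost z s.2.1 s.1 s.2.1) := by gcongr
        _ = _ := by rw [hε]; ring
    have hnn := hw.stageCost_nonneg z s.2.1 s.1 s.2.1
    have h5 : P.seqCost 1 M ω z θ (fun _ => s.2.1) s.1 s.2.1
        = P.stageCost z s.2.1 s.1 s.2.1
          + ω * P.tailCost M (P.traj (fun _ => s.2.1) z θ 1) s.1 s.2.1 θ := by
      simp [seqCost, traj]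
    rw [h5]
    nlinarith [mul_le_mul_of_nonneg_left hlast hω0.le, mul_le_mul_of_nonneg_right hω1 hnn]
  have h3 : P.seqCost (n + 1) M ω x θ u s.1 s.2.1
      = (∑ k ∈ Finset.range n, P.stageCost (P.traj u x θ (k + 1)) (u (k + 1)) s.1 s.2.1)
        + P.stageCost x (law.policy x θ) s.1 s.2.1 + ω * P.tailCost M z s.1 s.2.1 θ := by
    rw [seqCost, Finset.sum_range_succ', ← h0]; rfl
  linarith

end NominalDecrease

/-! ### Bounded reachable states and admissible gains -/

/-- Every step is a bounded perturbation of the stable nominal system at one fixed steady state,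
because inputs, parameters and disturbances are bounded and `f` is Lipschitz. A Lipschitz Lyapunov
function for that system then stays bounded. -/
theorem Regular.reachable_bounded (hr : P.Regular) (hs : P.OpenLoopStable)
    {X₀ : Set (Vec nx)} {W : Set (Vec nw)} (hX₀ : IsCompact X₀) (hW : IsCompact W) :
    ∃ B : ℝ, ∀ x, P.Reachable X₀ W x → ‖x‖ ≤ B := by
  obtain ⟨B₀, hB₀⟩ := hX₀.isBounded.exists_norm_le
  -- With no parameter, no step is possible and only `X₀` is reachable.
  rcases P.Θ.eq_empty_or_nonempty with hΘ | ⟨θ₀, hθ₀⟩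
  · refine ⟨B₀, fun x hx => ?_⟩
    cases hx with
    | init _ hx => exact hB₀ x hx
    | step x u θ w _ _ hθ => simp [hΘ] at hθ
  obtain ⟨⟨xs, us, ys⟩, -, hus, hfix, -⟩ := hr.nonempty θ₀ hθ₀
  dsimp only at hus hfix
  obtain ⟨BU, hBU⟩ := hr.compact_U.isBounded.exists_norm_le
  obtain ⟨BΘ, hBΘ⟩ := hr.compact_Θ.isBounded.exists_norm_le
  obtain ⟨BW, hBW⟩ := hW.isBounded.exists_norm_le
  obtain ⟨L, hL1, hL⟩ := hr.exists_lipschitz_f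
  choose a ha hlip using hr.exists_lipschitz_traj
  obtain ⟨Cρ, ρ, hCρ, hρ0, hρ1, hstab⟩ := hs
  have hlim : Filter.Tendsto (fun m : ℕ => Cρ * ρ ^ m) Filter.atTop (nhds (Cρ * 0)) :=
    (tendsto_pow_atTop_nhds_zero_of_lt_one hρ0.le hρ1).const_mul _
  rw [mul_zero] at hlim
  obtain ⟨m, hm⟩ := (hlim.eventually_lt_const (show (0 : ℝ) < 1 / 2 by norm_num)).exists
  -- `m` was chosen with `Cρ * ρ ^ m < 1 / 2`, so one nominal step lowers this sum by at least half
  -- of its first term.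
  set Λ : Vec nx → ℝ := fun x =>
    ∑ k ∈ Finset.range m, ‖P.traj (fun _ => us) x θ₀ k - xs‖ with hΛ
  have hΛ0 : ∀ x, 0 ≤ Λ x := fun x => Finset.sum_nonneg fun _ _ => norm_nonneg _
  set A : ℝ := m * Cρ + 1 with hA
  have hA0 : 0 < A := by positivity
  have hΛle : ∀ x, Λ x ≤ A * ‖x - xs‖ := fun x => by
    have h1 : ∀ k ∈ Finset.range m,
        ‖P.traj (fun _ => us) x θ₀ k - xs‖ ≤ Cρ * ‖x - xs‖ := fun k _ => by
      refine (hstab θ₀ hθ₀ xs us hus hfix x k).trans ?_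
      gcongr
      exact mul_le_of_le_one_right (by linarith) (pow_le_one₀ hρ0.le hρ1.le)
    have h2 := Finset.sum_le_sum h1
    rw [Finset.sum_const, Finset.card_range, nsmul_eq_mul] at h2
    simp only [hΛ, hA]
    linarith [norm_nonneg (x - xs)]
  have hdec : ∀ x, Λ (P.f x us θ₀ 0) + 1 / 2 * ‖x - xs‖ ≤ Λ x := fun x => by
    have e := Finset.sum_range_succ' (fun k => ‖P.traj (fun _ => us) x θ₀ k - xs‖) m
    rw [Finset.sum_range_succ] at e
    simp only [traj_succ' (fun _ => us)] at e
    have e0 : P.traj (fun _ => us) x θ₀ 0 = x := rfl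
    rw [e0] at e
    have h1 := (hstab θ₀ hθ₀ xs us hus hfix x m).trans
      (mul_le_mul_of_nonneg_right hm.le (norm_nonneg _))
    simp only [hΛ]
    linarith
  set a' := ∑ k ∈ Finset.range m, a k with ha'
  have ha'0 : 0 ≤ a' := Finset.sum_nonneg fun k _ => ha k
  have hΛlip : ∀ x x', Λ x' ≤ Λ x + a' * ‖x' - x‖ := fun x x' => by
    have h1 : ∀ k ∈ Finset.range m, ‖P.traj (fun _ => us) x' θ₀ k - xs‖
        ≤ ‖P.traj (fun _ => us) x θ₀ k - xs‖ + a k * ‖x' - x‖ := fun k _ => by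
      have h2 := hlip k (fun _ => us) (fun _ => us) (fun _ => hus) (fun _ => hus) x x' θ₀ hθ₀
        θ₀ hθ₀ 0 (by simp)
      rw [sub_self, norm_zero, add_zero, add_zero] at h2
      have h3 := norm_sub_le_norm_sub_add_norm_sub (P.traj (fun _ => us) x' θ₀ k)
        (P.traj (fun _ => us) x θ₀ k) xs
      linarith
    have h2 := Finset.sum_le_sum h1
    rwa [Finset.sum_add_distrib, ← Finset.sum_mul] at h2
  set e := L * ((BU + ‖us‖) + (BΘ + ‖θ₀‖) + BW) with he
  -- The first entry covers the initial states. The second is the fixed point of `t ↦ (1 - 1 / (2 *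
  -- A)) * t + a' * e`, which bounds one step of `Λ`.
  set R := max (A * (B₀ + ‖xs‖)) (2 * A * (a' * e)) with hR
  have hinv : ∀ x, P.Reachable X₀ W x → Λ x ≤ R := by
    intro x hx
    induction hx with
    | init x hx =>
      refine (hΛle x).trans (le_max_of_le_left ?_)
      gcongr
      exact (norm_sub_le _ _).trans (by gcongr; exact hB₀ x hx)
    | step x u θ w _ hu hθ hw ih =>
      have h1 := hΛlip (P.f x us θ₀ 0) (P.f x u θ w)
      have h2 : ‖P.f x u θ w - P.f x us θ₀ 0‖ ≤ e := by
        refine (hL x x u hu us hus θ hθ θ₀ hθ₀ w 0).trans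
          (mul_le_mul_of_nonneg_left ?_ (by linarith))
        rw [sub_self, norm_zero, zero_add, sub_zero]
        refine add_le_add (add_le_add ?_ ?_) (hBW w hw)
        · exact (norm_sub_le _ _).trans (by gcongr; exact hBU u hu)
        · exact (norm_sub_le _ _).trans (by gcongr; exact hBΘ θ hθ)
      have h3 := mul_le_mul_of_nonneg_left h2 ha'0
      have h4 := hdec x
      have h5 := hΛle x
      have h6 : 2 * A * (a' * e) ≤ R := le_max_right _ _
      have h7 : Λ x / A ≤ ‖x - xs‖ := by rw [div_le_iff₀ hA0]; linarith
      have h8 : a' * e ≤ R / (2 * A) := by rw [le_div_iff₀ (by positivity)]; linarith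
      have h9 : (1 - 1 / (2 * A)) * Λ x ≤ (1 - 1 / (2 * A)) * R := by
        refine mul_le_mul_of_nonneg_left ih ?_
        have : 1 / (2 * A) ≤ 1 := by
          rw [div_le_one (by positivity)]
          have : 0 ≤ (m : ℝ) * Cρ := by positivity
          rw [hA]; linarith
        linarith
      have e1 : (1 - 1 / (2 * A)) * Λ x = Λ x - 1 / 2 * (Λ x / A) := by field_simp
      have e2 : (1 - 1 / (2 * A)) * R = R - R / (2 * A) := by field_simp
      linarith
  refine ⟨2 * R + ‖xs‖, fun x hx => ?_⟩
  have h1 := hdec x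
  have h2 := hinv x hx
  have h3 := hΛ0 (P.f x us θ₀ 0)
  have h4 := norm_le_norm_sub_add x xs
  linarith

/-- The regressors at reachable measured states are uniformly bounded, so a small multiple of the
identity is admissible. -/
theorem Regular.exists_admissibleGain (hr : P.Regular) (hl : P.LinearlyParametrized)
    (hs : P.OpenLoopStable) {X₀ : Set (Vec nx)} {W : Set (Vec nw)} {V : Set (Vec nx)}
    (hX₀ : IsCompact X₀) (hW : IsCompact W) (hV : IsCompact V) :
    ∃ Γ, P.AdmissibleGain X₀ W V Γ := by
  obtain ⟨BX, hBX⟩ := hr.reachable_bounded hs hX₀ hW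
  obtain ⟨BV, hBV⟩ := hV.isBounded.exists_norm_le
  have hcomp : IsCompact (Metric.closedBall (0 : Vec nx) (BX + BV) ×ˢ P.U ×ˢ
      Metric.closedBall (0 : Vec np) 1) :=
    (isCompact_closedBall _ _).prod (hr.compact_U.prod (isCompact_closedBall _ _))
  -- Continuity of the regressor action comes from `f`: it is a difference of two of its values.
  have hcont : Continuous fun z : Vec nx × Vec nu × Vec np =>
      mulV (P.G z.1 z.2.1 0) z.2.2 := by
    have e : (fun z : Vec nx × Vec nu × Vec np => mulV (P.G z.1 z.2.1 0) z.2.2)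
        = fun z => P.f z.1 z.2.1 z.2.2 0 - P.f z.1 z.2.1 0 0 := by
      funext z; rw [hl z.1 z.2.1 z.2.2 0]; abel
    rw [e]
    exact (hr.contDiff_f.continuous.comp (f := fun z : Vec nx × Vec nu × Vec np =>
        (z.1, z.2.1, z.2.2, (0 : Vec nw))) (by fun_prop)).sub
      (hr.contDiff_f.continuous.comp (f := fun z : Vec nx × Vec nu × Vec np =>
        (z.1, z.2.1, (0 : Vec np), (0 : Vec nw))) (by fun_prop))
  obtain ⟨B, hB⟩ := hcomp.exists_bound_of_continuousOn hcont.continuousOn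
  have hbound : ∀ x, P.Reachable X₀ W x → ∀ u ∈ P.U, ∀ v ∈ V, ∀ z : Vec np,
      ‖mulV (P.G (x + v) u 0) z‖ ≤ |B| * ‖z‖ := by
    intro x hx u hu v hv z
    by_cases hz : z = 0
    · simp [hz, mulV]
    have hn : 0 < ‖z‖ := norm_pos_iff.2 hz
    have h1 := hB (x + v, u, ‖z‖⁻¹ • z) ⟨by
      simpa using (norm_add_le _ _).trans (add_le_add (hBX x hx) (hBV v hv)), hu, by
      simp [norm_smul, hn.ne']⟩
    dsimp only at h1
    rw [mulV_smul, norm_smul, norm_inv, norm_norm, inv_mul_le_iff₀ hn] at h1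
    rw [mul_comm]
    exact h1.trans (mul_le_mul_of_nonneg_left (le_abs_self B) hn.le)
  have hg : 0 < (B ^ 2 + 1)⁻¹ := by positivity
  refine ⟨(B ^ 2 + 1)⁻¹ • 1, Matrix.PosDef.one.smul hg, fun x hx u hu v hv => ?_⟩
  set Φ := P.G (x + v) u 0
  have hT := norm_mulV_transpose_le (abs_nonneg B) (hbound x hx u hu v hv)
  refine Matrix.PosSemidef.of_dotProduct_mulVec_nonneg ?_ fun z => ?_
  · simp [Matrix.IsHermitian, Matrix.conjTranspose_eq_transpose_of_trivial, Matrix.transpose_mul]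
  · have e1 := EuclideanSpace.real_norm_sq_eq (mulV Φ.transpose (WithLp.toLp 2 z))
    have e2 := EuclideanSpace.real_norm_sq_eq (WithLp.toLp 2 z)
    have h1 := pow_le_pow_left₀ (norm_nonneg _) (hT (WithLp.toLp 2 z)) 2
    rw [mul_pow, sq_abs] at h1
    have e3 : star z ⬝ᵥ (1 - Φ * ((B ^ 2 + 1)⁻¹ • (1 : Matrix (Fin np) (Fin np) ℝ))
        * Φ.transpose).mulVec z
        = ‖WithLp.toLp 2 z‖ ^ 2
          - (B ^ 2 + 1)⁻¹ * ‖mulV Φ.transpose (WithLp.toLp 2 z)‖ ^ 2 := by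
      rw [e1, e2]
      simp only [star_trivial, Matrix.sub_mulVec, Matrix.one_mulVec, dotProduct_sub,
        Matrix.mul_smul, Matrix.mul_one, Matrix.smul_mul, Matrix.smul_mulVec, dotProduct_smul,
        ← Matrix.mulVec_mulVec, smul_eq_mul]
      rw [Matrix.dotProduct_mulVec z, ← Matrix.mulVec_transpose]
      simp [dotProduct, sq, mulV]
    rw [e3, sub_nonneg, inv_mul_le_iff₀ (by positivity)]
    nlinarith [sq_nonneg ‖WithLp.toLp 2 z‖]

/-! ### Regularity of the setpoints -/

section Setpoints

/-- Steady states depend on outputs and parameters in a Lipschitz continuous way. -/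
theorem SteadyRegular.exists_setpoint_lipschitz (hst : P.SteadyRegular)
    (hw : P.PositiveWeights) : ∃ C : ℝ, 0 < C ∧ ∀ θ ∈ P.Θ, ∀ θ' ∈ P.Θ, ∀ s ∈ P.S θ,
      ∀ s' ∈ P.S θ', ‖s.1 - s'.1‖ ^ 2 + ‖s.2.1 - s'.2.1‖ ^ 2
        ≤ C * (wsq P.T (s.2.2 - s'.2.2) + ‖θ - θ'‖ ^ 2) := by
  obtain ⟨gx, gu, hg, ⟨L, hL0, hL⟩, -⟩ := hst.setpoint_map
  obtain ⟨cQ, hcQ, hQ⟩ := exists_norm_sq_le_wsq hw.Q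
  obtain ⟨cR, hcR, hR⟩ := exists_norm_sq_le_wsq hw.R
  refine ⟨(cQ + cR) * (L + 1), by positivity, fun θ hθ θ' hθ' s hs s' hs' => ?_⟩
  have h := hL θ hθ θ' hθ' s.2.2 s'.2.2
  rw [← (hg θ hθ s hs).1, ← (hg θ hθ s hs).2, ← (hg θ' hθ' s' hs').1,
    ← (hg θ' hθ' s' hs').2] at h
  have hq := wsq_nonneg hw.Q.posSemidef (s.1 - s'.1)
  have hr := wsq_nonneg hw.R.posSemidef (s.2.1 - s'.2.1)
  have ht := wsq_nonneg hw.T.posSemidef (s.2.2 - s'.2.2)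
  have h1 := hQ (s.1 - s'.1)
  have h2 := hR (s.2.1 - s'.2.1)
  have h3 : cQ * wsq P.Q (s.1 - s'.1) + cR * wsq P.R (s.2.1 - s'.2.1)
      ≤ (cQ + cR) * (wsq P.Q (s.1 - s'.1) + wsq P.R (s.2.1 - s'.2.1)) := by
    nlinarith [mul_nonneg hcQ.le hr, mul_nonneg hcR.le hq]
  calc _ ≤ (cQ + cR) * (wsq P.Q (s.1 - s'.1) + wsq P.R (s.2.1 - s'.2.1)) := by linarith
    _ ≤ (cQ + cR) * ((L + 1) * (wsq P.T (s.2.2 - s'.2.2) + ‖θ - θ'‖ ^ 2)) := by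
        gcongr
        refine h.trans ?_
        gcongr
        linarith
    _ = _ := by ring

/-- Feasible setpoints whose output lies on the segment to the target. -/
theorem SteadyRegular.exists_setpoint_between (hst : P.SteadyRegular) {θ : Vec np}
    (hθ : θ ∈ P.Θ) {s s₀ : Vec nx × Vec nu × Vec ny} (hs : s ∈ P.S θ) (hs₀ : s₀ ∈ P.S θ)
    {β : ℝ} (hβ : β ∈ Set.Icc (0 : ℝ) 1) :
    ∃ s' ∈ P.S θ, wsq P.T (s'.2.2 - s₀.2.2) = β ^ 2 * wsq P.T (s.2.2 - s₀.2.2) ∧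
      wsq P.T (s.2.2 - s'.2.2) = (1 - β) ^ 2 * wsq P.T (s.2.2 - s₀.2.2) := by
  obtain ⟨gx, gu, -, -, hc⟩ := hst.setpoint_map
  refine ⟨_, hc θ hθ s hs s₀ hs₀ β hβ, ?_, ?_⟩
  · rw [← wsq_smul]; congr 1; module
  · rw [← wsq_smul]; congr 1; module

end Setpoints

theorem norm_sub_sq_le {E : Type*} [SeminormedAddCommGroup E] (x y z : E) :
    ‖x - z‖ ^ 2 ≤ 2 * ‖x - y‖ ^ 2 + 2 * ‖y - z‖ ^ 2 := by
  have h := pow_le_pow_left₀ (norm_nonneg _) (norm_sub_le_norm_sub_add_norm_sub x y z) 2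
  nlinarith [sq_nonneg (‖x - y‖ - ‖y - z‖)]

/-! ### Value function: bounds, continuity, contraction -/

namespace MPCLaw

variable {N M : ℕ} {ω : ℝ} (law : P.MPCLaw N M ω)

theorem stageCost_add_le_value (hw : P.PositiveWeights) (hN : 1 ≤ N) (hω : 0 < ω) (x : Vec nx)
    {θ : Vec np} (hθ : θ ∈ P.Θ) :
    P.stageCost x (law.policy x θ) (law.setpoint x θ).1 (law.setpoint x θ).2.1
      + wsq P.T ((law.setpoint x θ).2.2 - P.yd) ≤ law.value x θ := by
  obtain ⟨u, -, h0, hval⟩ := law.exists_inputs hN x hθ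
  rw [hval, ← h0]
  have h := hw.sum_stageCost_le_seqCost hN M hω.le x θ u (law.setpoint x θ).1
    (law.setpoint x θ).2.1
  rw [Finset.sum_range_one] at h
  exact add_le_add_left h _

theorem value_nonneg (hw : P.PositiveWeights) (hN : 1 ≤ N) (hω : 0 < ω) (x : Vec nx)
    {θ : Vec np} (hθ : θ ∈ P.Θ) : 0 ≤ law.value x θ :=
  (add_nonneg (hw.stageCost_nonneg _ _ _ _) (wsq_nonneg hw.T.posSemidef _)).trans
    (law.stageCost_add_le_value hw hN hω x hθ)

/-- The value function is bounded by the first stage cost: otherwise moving the artificial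
setpoint towards the target would be cheaper. -/
theorem exists_value_le_stageCost (hw : P.PositiveWeights) (hst : P.SteadyRegular)
    (hs : P.OpenLoopStable) (hN : 1 ≤ N) (hω : 0 < ω)
    (htarget : ∀ θ ∈ P.Θ, ∃ s ∈ P.S θ, s.2.2 = P.yd) :
    ∃ C : ℝ, 0 < C ∧ ∀ x, ∀ θ ∈ P.Θ, law.value x θ
      ≤ C * P.stageCost x (law.policy x θ) (law.setpoint x θ).1 (law.setpoint x θ).2.1 := by
  obtain ⟨κ₀, hκ₀, hκ⟩ := exists_seqCost_const_le hw hs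
  obtain ⟨c, hc, hQ⟩ := exists_norm_sq_le_wsq hw.Q
  obtain ⟨Cg, hCg, hg⟩ := hst.exists_setpoint_lipschitz hw
  set κ := κ₀ * (1 + ω) with hκdef
  have hκpos : 0 < κ := by positivity
  -- With this fraction the extra tracking cost `2 κ Cg δ² t` is at most `δ t / 2`, while the offset
  -- cost falls by at least `δ t`.
  set δ := (4 * κ * Cg + 1)⁻¹ with hδ
  have hδ0 : 0 < δ := by positivity
  have hδ1 : δ ≤ 1 := inv_le_one_of_one_le₀ (le_add_of_nonneg_left (by positivity))
  have hδe : δ * (4 * κ * Cg + 1) = 1 := inv_mul_cancel₀ (by positivity)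
  refine ⟨κ * c + 4 * κ * c / δ, by positivity, fun x θ hθ => ?_⟩
  have hmem := law.setpoint_mem x hθ
  have hlow := law.stageCost_add_le_value hw hN hω x hθ
  set s := law.setpoint x θ
  set ℓ := P.stageCost x (law.policy x θ) s.1 s.2.1 with hℓ
  have hℓ0 : 0 ≤ ℓ := hw.stageCost_nonneg _ _ _ _
  have hxs : ‖x - s.1‖ ^ 2 ≤ c * ℓ :=
    (hQ _).trans (mul_le_mul_of_nonneg_left (hw.wsqQ_le_stageCost _ _ _ _) hc.le)
  obtain ⟨s₀, hs₀, hy₀⟩ := htarget θ hθ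
  obtain ⟨s', hs', h1, h2⟩ := hst.exists_setpoint_between hθ hmem hs₀
    (β := 1 - δ) ⟨by linarith, by linarith⟩
  rw [hy₀] at h1 h2
  set t := wsq P.T (s.2.2 - P.yd) with ht
  have ht0 : 0 ≤ t := wsq_nonneg hw.T.posSemidef _
  have h3 := law.value_le x hθ (fun _ => hs'.2.1) hs'
  have h4 := hκ N M ω hω.le θ hθ s' hs' x
  have h5 := hg θ hθ θ hθ s hmem s' hs'
  rw [sub_self, norm_zero, h2] at h5
  have h6 := norm_sub_sq_le x s.1 s'.1
  have h7 : ‖x - s'.1‖ ^ 2 ≤ 2 * (c * ℓ) + 2 * (Cg * (δ ^ 2 * t)) := by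
    have : (1 - (1 - δ)) ^ 2 = δ ^ 2 := by ring
    rw [this] at h5
    linarith [sq_nonneg ‖s.2.1 - s'.2.1‖]
  have h8 : κ * ‖x - s'.1‖ ^ 2 ≤ 2 * κ * c * ℓ + δ * t / 2 := by
    have e : κ * (2 * (c * ℓ) + 2 * (Cg * (δ ^ 2 * t)))
        = 2 * κ * c * ℓ + (δ * t / 2) * (δ * (4 * κ * Cg)) := by ring
    have h9 : δ * (4 * κ * Cg) ≤ 1 := by linarith
    have h10 := mul_le_mul_of_nonneg_left h7 hκpos.le
    rw [e] at h10
    have h11 := mul_le_mul_of_nonneg_left h9 (show 0 ≤ δ * t / 2 by positivity)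
    linarith
  rw [h1] at h3
  have h12 : δ * t / 2 ≤ 2 * κ * c * ℓ := by
    have h13 : 0 ≤ δ * (1 - δ) * t := mul_nonneg (mul_nonneg hδ0.le (by linarith)) ht0
    nlinarith
  have h14 : t ≤ 4 * κ * c / δ * ℓ := by
    rw [div_mul_eq_mul_div, le_div_iff₀ hδ0]; linarith
  have h15 := law.value_le x hθ (fun _ => hmem.2.1) hmem
  have h16 := hκ N M ω hω.le θ hθ s hmem x
  have h17 := mul_le_mul_of_nonneg_left hxs hκpos.le
  linarith

/-- Relaxed continuity of the value function in the state and the parameter. -/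
theorem exists_value_le_value (hw : P.PositiveWeights) (hr : P.Regular)
    (hst : P.SteadyRegular) (hN : 1 ≤ N) (hω : 0 < ω) {ε : ℝ} (hε : 0 < ε) :
    ∃ C : ℝ, 0 < C ∧ ∀ x x', ∀ θ ∈ P.Θ, ∀ θ' ∈ P.Θ,
      law.value x' θ' ≤ (1 + ε) * law.value x θ + C * (‖x' - x‖ ^ 2 + ‖θ' - θ‖ ^ 2) := by
  obtain ⟨C₁, hC₁, hcost⟩ := hw.exists_seqCost_le hr N M hω.le hε
  obtain ⟨Cg, hCg, hg⟩ := hst.exists_setpoint_lipschitz hw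
  obtain ⟨L₀, hL₀⟩ := hst.output_lipschitz
  set L := max L₀ 0 with hLdef
  have hL0 : 0 ≤ L := le_max_right _ _
  refine ⟨4 * C₁ * (1 + Cg * (L + 1)) + (1 + ε⁻¹) * L, by positivity, ?_⟩
  intro x x' θ hθ θ' hθ'
  obtain ⟨u, hu, -, hval⟩ := law.exists_inputs hN x hθ
  have hmem := law.setpoint_mem x hθ
  set s := law.setpoint x θ
  -- The candidate keeps the optimal inputs for `(x, θ)` and moves to a nearby setpoint feasible for
  -- `θ'`.
  obtain ⟨s', hs', hy⟩ := hL₀ θ hθ θ' hθ' s hmem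
  have hy' : wsq P.T (s'.2.2 - s.2.2) ≤ L * ‖θ' - θ‖ ^ 2 := by
    rw [wsq_sub_comm, norm_sub_rev]
    exact hy.trans (mul_le_mul_of_nonneg_right (le_max_left _ _) (sq_nonneg _))
  have h1 := law.value_le x' hθ' hu hs'
  have h2 := hcost u hu s.2.1 hmem.2.1 s'.2.1 hs'.2.1 θ hθ θ' hθ' x x' s.1 s'.1
  have h3 := hg θ' hθ' θ hθ s' hs' s hmem
  have h4 : ‖s'.1 - s.1‖ ^ 2 + ‖s'.2.1 - s.2.1‖ ^ 2 ≤ Cg * (L + 1) * ‖θ' - θ‖ ^ 2 := by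
    refine h3.trans ?_
    rw [mul_assoc]
    refine mul_le_mul_of_nonneg_left ?_ hCg.le
    linarith
  have h5 := wsq_add_le hw.T.posSemidef hε (s.2.2 - P.yd) (s'.2.2 - s.2.2)
  rw [show s.2.2 - P.yd + (s'.2.2 - s.2.2) = s'.2.2 - P.yd by abel] at h5
  have h6 : ∀ a b c d : ℝ, (a + b + c + d) ^ 2 ≤ 4 * (a ^ 2 + b ^ 2 + c ^ 2 + d ^ 2) := by
    intro a b c d
    nlinarith [sq_nonneg (a - b), sq_nonneg (a - c), sq_nonneg (a - d), sq_nonneg (b - c),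
      sq_nonneg (b - d), sq_nonneg (c - d)]
  have h7 := mul_le_mul_of_nonneg_left
    (h6 ‖x' - x‖ ‖θ' - θ‖ ‖s'.1 - s.1‖ ‖s'.2.1 - s.2.1‖) hC₁.le
  have h8 := mul_le_mul_of_nonneg_left h4 (show 0 ≤ 4 * C₁ by positivity)
  have h9 := mul_le_mul_of_nonneg_left hy' (show 0 ≤ 1 + ε⁻¹ by positivity)
  have h10 : 0 ≤ (4 * C₁ * (Cg * (L + 1)) + (1 + ε⁻¹) * L) * ‖x' - x‖ ^ 2 := by positivity
  rw [hval]
  linarith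

/-- The value function contracts along the perturbed closed loop. -/
theorem exists_value_contraction (hw : P.PositiveWeights) (hr : P.Regular)
    (hst : P.SteadyRegular) (hs : P.OpenLoopStable) (hN : 1 ≤ N) (hω : 0 < ω)
    (htarget : ∀ θ ∈ P.Θ, ∃ s ∈ P.S θ, s.2.2 = P.yd)
    {α : ℝ} (hα : 0 < α) (hdec : law.NominalDecrease α) :
    ∃ c C : ℝ, 0 < c ∧ c ≤ 1 ∧ 0 < C ∧ ∀ x x', ∀ θ ∈ P.Θ, ∀ θ' ∈ P.Θ,
      law.value x' θ' ≤ (1 - c) * law.value x θ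
        + C * (‖x' - P.f x (law.policy x θ) θ 0‖ ^ 2 + ‖θ' - θ‖ ^ 2) := by
  obtain ⟨K, hK, hle⟩ := law.exists_value_le_stageCost hw hst hs hN hω htarget
  -- The decrease `α ℓ` is at least `2 ε` times the value; continuity spends one `ε`.
  set ε := α / (2 * K) with hε
  have hε0 : 0 < ε := by positivity
  obtain ⟨C, hC, hcont⟩ := law.exists_value_le_value hw hr hst hN hω hε0
  refine ⟨min ε 1, C, lt_min hε0 one_pos, min_le_right _ _, hC, fun x x' θ hθ θ' hθ' => ?_⟩
  have h1 := hcont (P.f x (law.policy x θ) θ 0) x' θ hθ θ' hθ'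
  have h2 := hdec x θ hθ
  have h3 := mul_le_mul_of_nonneg_left (hle x θ hθ) hε0.le
  set ℓ := P.stageCost x (law.policy x θ) (law.setpoint x θ).1 (law.setpoint x θ).2.1
  have hℓ : 0 ≤ ℓ := hw.stageCost_nonneg _ _ _ _
  have e : ε * (K * ℓ) = α / 2 * ℓ := by rw [hε]; field_simp
  rw [e] at h3
  have h4 : law.value (P.f x (law.policy x θ) θ 0) θ ≤ law.value x θ := by
    linarith [mul_nonneg hα.le hℓ]
  have h5 := mul_le_mul_of_nonneg_left h4 hε0.le
  have h6 := mul_le_mul_of_nonneg_right (min_le_left ε 1) (law.value_nonneg hw hN hω x hθ)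
  linarith

/-- The value bounds the distances from measured state and input to the artificial setpoint, and
from its output to the target. As `h` ignores the parameter, the true output may be evaluated at the
estimate. -/
theorem exists_output_le (hw : P.PositiveWeights) (hr : P.Regular) (hN : 1 ≤ N) (hω : 0 < ω)
    (hout : ∀ x, ∀ u ∈ P.U, ∀ θ ∈ P.Θ, ∀ θ' ∈ P.Θ, P.h x u θ = P.h x u θ') :
    ∃ C : ℝ, 0 < C ∧ ∀ x xm, ∀ θ ∈ P.Θ, ∀ θe ∈ P.Θ,
      ‖P.h x (law.policy xm θe) θ - P.yd‖ ^ 2 + Metric.infDist x P.X ^ 2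
        ≤ C * (law.value xm θe + ‖xm - x‖ ^ 2) := by
  obtain ⟨L, hL1, hL⟩ := hr.exists_lipschitz_h
  obtain ⟨cQ, hcQ, hQ⟩ := exists_norm_sq_le_wsq hw.Q
  obtain ⟨cR, hcR, hR⟩ := exists_norm_sq_le_wsq hw.R
  obtain ⟨cT, hcT, hT⟩ := exists_norm_sq_le_wsq hw.T
  refine ⟨(4 * L ^ 2 + 1) * (2 * cQ + cR + 2) + 2 * cT, by positivity, ?_⟩
  intro x xm θ hθ θe hθe
  have hmem := law.setpoint_mem xm hθe
  have hval := law.stageCost_add_le_value hw hN hω xm hθe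
  have hu := law.policy_mem hN xm hθe
  set s := law.setpoint xm θe
  set u := law.policy xm θe
  have h1 := hw.wsqQ_le_stageCost xm u s.1 s.2.1
  have h2 := hw.wsqR_le_stageCost xm u s.1 s.2.1
  have hT0 := wsq_nonneg hw.T.posSemidef (s.2.2 - P.yd)
  have hℓ0 := hw.stageCost_nonneg xm u s.1 s.2.1
  set J := law.value xm θe
  have hJ0 : 0 ≤ J := by linarith
  have h3 : ‖xm - s.1‖ ^ 2 ≤ cQ * J := (hQ _).trans (by gcongr; linarith)
  have h4 : ‖u - s.2.1‖ ^ 2 ≤ cR * J := (hR _).trans (by gcongr; linarith)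
  have h5 : ‖s.2.2 - P.yd‖ ^ 2 ≤ cT * J := (hT _).trans (by gcongr; linarith)
  have h6 := norm_sub_sq_le x xm s.1
  rw [norm_sub_rev x xm] at h6
  set v2 := ‖xm - x‖ ^ 2 with hv2
  have hv0 : 0 ≤ v2 := sq_nonneg _
  -- The artificial steady state lies in `P.X`.
  have h7 : Metric.infDist x P.X ^ 2 ≤ ‖x - s.1‖ ^ 2 := by
    rw [← dist_eq_norm]
    exact pow_le_pow_left₀ Metric.infDist_nonneg (Metric.infDist_le_dist_of_mem hmem.1) 2
  have h8 : ‖P.h x u θ - s.2.2‖ ^ 2 ≤ 2 * L ^ 2 * (‖x - s.1‖ ^ 2 + ‖u - s.2.1‖ ^ 2) := by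
    rw [hout x u hu θ hθ θe hθe, hmem.2.2.2]
    have h9 := hL x s.1 u hu s.2.1 hmem.2.1 θe hθe θe hθe
    rw [sub_self, norm_zero, add_zero] at h9
    refine (pow_le_pow_left₀ (norm_nonneg _) h9 2).trans ?_
    rw [mul_pow]
    nlinarith [mul_nonneg (sq_nonneg L) (sq_nonneg (‖x - s.1‖ - ‖u - s.2.1‖))]
  have h10 := norm_sub_sq_le (P.h x u θ) s.2.2 P.yd
  have h11 : ‖x - s.1‖ ^ 2 + ‖u - s.2.1‖ ^ 2 ≤ (2 * cQ + cR + 2) * (J + v2) := by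
    have : 0 ≤ 2 * J := by positivity
    have : 0 ≤ (2 * cQ + cR) * v2 := by positivity
    linarith
  have h12 := mul_le_mul_of_nonneg_left h11 (show 0 ≤ 4 * L ^ 2 + 1 by positivity)
  have h13 : 0 ≤ cT * v2 := by positivity
  linarith [sq_nonneg ‖u - s.2.1‖]

/-- The candidate holds the target steady state of the estimate: zero offset, and a state within
Lipschitz distance of the one for `θ`. -/
theorem exists_value_initial_le (hw : P.PositiveWeights) (hst : P.SteadyRegular)
    (hs : P.OpenLoopStable) (hω : 0 < ω) :
    ∃ C : ℝ, 0 < C ∧ ∀ x xm, ∀ θ ∈ P.Θ, ∀ θe ∈ P.Θ, ∀ s ∈ P.S θ, ∀ se ∈ P.S θe,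
      s.2.2 = P.yd → se.2.2 = P.yd →
      law.value xm θe ≤ C * (‖xm - x‖ ^ 2 + ‖x - s.1‖ ^ 2 + ‖θ - θe‖ ^ 2) := by
  obtain ⟨κ₀, hκ₀, hκ⟩ := exists_seqCost_const_le hw hs
  obtain ⟨Cg, hCg, hg⟩ := hst.exists_setpoint_lipschitz hw
  set κ := κ₀ * (1 + ω) with hκdef
  have hκpos : 0 < κ := by positivity
  refine ⟨κ * (4 + 4 * Cg), by positivity, fun x xm θ hθ θe hθe s hs se hse hy hye => ?_⟩
  have h1 := law.value_le xm hθe (fun _ => hse.2.1) hse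
  have h2 := hκ N M ω hω.le θe hθe se hse xm
  have h3 := hg θ hθ θe hθe s hs se hse
  have h0 : wsq P.T 0 = 0 := by simp [wsq]
  rw [hy, hye, sub_self, h0, zero_add] at h3
  rw [hye, sub_self, h0] at h1
  have h4 := norm_sub_sq_le xm x se.1
  have h5 := norm_sub_sq_le x s.1 se.1
  have h6 : ‖xm - se.1‖ ^ 2 ≤ (4 + 4 * Cg) * (‖xm - x‖ ^ 2 + ‖x - s.1‖ ^ 2 + ‖θ - θe‖ ^ 2) := by
    have : 0 ≤ Cg * (‖xm - x‖ ^ 2 + ‖x - s.1‖ ^ 2) := by positivity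
    linarith [sq_nonneg ‖s.2.1 - se.2.1‖, sq_nonneg ‖xm - x‖, sq_nonneg ‖θ - θe‖]
  have h7 := mul_le_mul_of_nonneg_left h6 hκpos.le
  linarith

end MPCLaw

/-! ### Parameter adaptation -/

section Adaptation

/-- One step of the projected gradient adaptation decreases the weighted parameter error by the
squared prediction error that is caused by it, up to the squared residual `d`. -/
theorem IsProjection.wsq_error_le (hr : P.Regular) {Γ : Matrix (Fin np) (Fin np) ℝ}
    (hΓ : Γ.PosDef) {Φ : Matrix (Fin nx) (Fin np) ℝ}
    (hΦ : (1 - Φ * Γ * Φ.transpose).PosSemidef) {θ θe θe' : Vec np} {d : Vec nx}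
    (hp : P.IsProjection Γ (θe + mulV (Γ * Φ.transpose) (mulV Φ (θ - θe) + d)) θe')
    (hθ : θ ∈ P.Θ) :
    wsq Γ⁻¹ (θe' - θ) + ‖mulV Φ (θ - θe)‖ ^ 2 ≤ wsq Γ⁻¹ (θe - θ) + ‖d‖ ^ 2 := by
  have h := wsq_sub_le_of_isMinOn hΓ.inv.posSemidef hr.convex_Θ hp.1 hp.2 hθ
  rw [add_sub_right_comm, wsq_inv_add_gain hΓ] at h
  -- Admissibility bounds the quadratic term by `‖z + d‖²`; with the cross term `-2 ⟪z + d, z⟫` this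
  -- leaves `‖d‖² - ‖z‖²`.
  have h1 := wsq_le_of_posSemidef_one_sub hΦ (mulV Φ (θ - θe) + d)
  have e : mulV Φ (θe - θ) = -mulV Φ (θ - θe) := by rw [mulV_sub, mulV_sub]; abel
  rw [e] at h
  set z := mulV Φ (θ - θe)
  rw [inner_neg_right, inner_add_left, real_inner_self_eq_norm_sq, real_inner_comm] at h
  rw [norm_add_sq_real] at h1
  linarith

/-- Compare the projection with the old estimate, which is feasible. This controls the parameter
change seen by the value function. -/
theorem IsProjection.wsq_step_le (hr : P.Regular) {Γ : Matrix (Fin np) (Fin np) ℝ}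
    (hΓ : Γ.PosDef) {Φ : Matrix (Fin nx) (Fin np) ℝ}
    (hΦ : (1 - Φ * Γ * Φ.transpose).PosSemidef) {θe θe' : Vec np} {e : Vec nx}
    (hp : P.IsProjection Γ (θe + mulV (Γ * Φ.transpose) e) θe') (hθe : θe ∈ P.Θ) :
    wsq Γ⁻¹ (θe' - θe) ≤ ‖e‖ ^ 2 := by
  have h := wsq_sub_le_of_isMinOn hΓ.inv.posSemidef hr.convex_Θ hp.1 hp.2 hθe
  rw [add_sub_right_comm, wsq_inv_add_gain hΓ, sub_self] at h
  have h1 := wsq_le_of_posSemidef_one_sub hΦ e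
  have e1 : mulV Φ 0 = 0 := by simp [mulV]
  have e2 : wsq Γ⁻¹ 0 = 0 := by simp [wsq]
  rw [e1, e2, inner_zero_right] at h
  linarith

/-- On a bounded set a quadratic form is Lipschitz. This is why the parameter variation enters the
final bound unsquared. -/
theorem Regular.exists_wsq_sub_le (hr : P.Regular) {A : Matrix (Fin np) (Fin np) ℝ}
    (hA : A.IsHermitian) : ∃ C : ℝ, 0 < C ∧ ∀ η ∈ P.Θ, ∀ θ ∈ P.Θ, ∀ θ' ∈ P.Θ,
      wsq A (η - θ') ≤ wsq A (η - θ) + C * ‖θ' - θ‖ := by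
  obtain ⟨B, hB⟩ := hr.compact_Θ.isBounded.exists_norm_le
  obtain ⟨C, hC, hbil⟩ := exists_bil_le A
  refine ⟨C * (6 * |B|) + 1, by positivity, fun η hη θ hθ θ' hθ' => ?_⟩
  have hb : ∀ a ∈ P.Θ, ∀ b ∈ P.Θ, ‖a - b‖ ≤ 2 * |B| := fun a ha b hb => by
    have := norm_sub_le a b
    linarith [hB a ha, hB b hb, le_abs_self B]
  have e : η - θ' = (η - θ) + (θ - θ') := by abel
  rw [e, wsq_add hA, wsq_eq_bil A (θ - θ')]
  have h1 := (le_abs_self _).trans (hbil (η - θ) (θ - θ'))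
  have h2 := (le_abs_self _).trans (hbil (θ - θ') (θ - θ'))
  rw [norm_sub_rev θ θ'] at h1 h2
  have hn := norm_nonneg (θ' - θ)
  have h3 : C * ‖η - θ‖ * ‖θ' - θ‖ ≤ C * (2 * |B|) * ‖θ' - θ‖ := by
    gcongr; exact hb η hη θ hθ
  have h4 : C * ‖θ' - θ‖ * ‖θ' - θ‖ ≤ C * (2 * |B|) * ‖θ' - θ‖ := by
    gcongr; exact hb θ' hθ' θ hθ
  linarith

end Adaptation

/-- Summation of a contracting sequence `J` that is driven by the prediction errors `z` of an
adaptation scheme with parameter error `E`, and by residuals `d`. -/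
theorem sum_le_of_contraction {J E z d a p : ℕ → ℝ} {c C D : ℝ} (hc1 : c ≤ 1)
    (hC : 0 ≤ C) (hD : 0 ≤ D) (hJ : ∀ k, 0 ≤ J k) (hE : ∀ k, 0 ≤ E k) (ha : ∀ k, 0 ≤ a k)
    (hp : ∀ k, 0 ≤ p k)
    (hJs : ∀ k, J (k + 1) ≤ (1 - c) * J k + C * (z k + d k))
    (hEs : ∀ k, E (k + 1) + z k ≤ E k + d k + p k)
    (hd : ∀ k, d k ≤ D * (a k + a (k + 1))) (n : ℕ) :
    c * ∑ k ∈ Finset.range (n + 1), J k ≤ J 0 + C * E 0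
      + 4 * C * D * ∑ k ∈ Finset.range (n + 1), a k + C * ∑ k ∈ Finset.range (n + 1), p k := by
  have h1 : ∀ n, c * ∑ k ∈ Finset.range n, J k + J n
      ≤ J 0 + C * (∑ k ∈ Finset.range n, z k + ∑ k ∈ Finset.range n, d k) := by
    intro n
    induction n with
    | zero => simp
    | succ n ih =>
      simp only [Finset.sum_range_succ]
      linarith [hJs n]
  have h2 : ∀ n, ∑ k ∈ Finset.range n, z k + E n
      ≤ E 0 + ∑ k ∈ Finset.range n, d k + ∑ k ∈ Finset.range n, p k := by
    intro n
    induction n with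
    | zero => simp
    | succ n ih =>
      simp only [Finset.sum_range_succ]
      linarith [hEs n]
  -- Only residuals before `n` occur, so the shifted noise `a (k + 1)` stays within `range (n + 1)`.
  have h3 : ∑ k ∈ Finset.range n, d k ≤ D * (2 * ∑ k ∈ Finset.range (n + 1), a k) := by
    refine (Finset.sum_le_sum fun k _ => hd k).trans ?_
    rw [← Finset.mul_sum, Finset.sum_add_distrib]
    refine mul_le_mul_of_nonneg_left ?_ hD
    have e1 := Finset.sum_range_succ a n
    have e2 := Finset.sum_range_succ' a n
    linarith [ha n, ha 0]
  have h4 : ∑ k ∈ Finset.range n, p k ≤ ∑ k ∈ Finset.range (n + 1), p k := by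
    rw [Finset.sum_range_succ]; linarith [hp n]
  have h5 : ∑ k ∈ Finset.range n, z k + ∑ k ∈ Finset.range n, d k
      ≤ E 0 + 2 * (D * (2 * ∑ k ∈ Finset.range (n + 1), a k))
        + ∑ k ∈ Finset.range (n + 1), p k := by
    linarith [h2 n, hE n]
  have h6 := mul_le_mul_of_nonneg_left h5 hC
  -- The leftover `J n` supplies the last summand, as `c ≤ 1`; no noise at time `n + 1` is needed.
  have h7 := mul_le_mul_of_nonneg_right hc1 (hJ n)
  rw [Finset.sum_range_succ J]
  linarith [h1 n]

/-- Here `S` sums the values, `A` the squared disturbances and noise, `T` the parameter variation;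
`J`, `E` are the initial storage values and `I` the initial error. -/
theorem bound_of_weighted_sum_le {c C D Cp Ci Ce Co S J E A T I : ℝ} (hc : 0 < c) (hC : 0 ≤ C)
    (hD : 0 ≤ D) (hCp : 0 ≤ Cp) (hCi : 0 ≤ Ci) (hCo : 0 ≤ Co) (hA : 0 ≤ A) (hT : 0 ≤ T)
    (hJ : J ≤ Ci * (A + I)) (hE : E ≤ Ce * I)
    (h : c * S ≤ J + C * E + 4 * C * D * A + C * (Cp * T)) :
    Co * (S + A) ≤ Co * (c⁻¹ * (4 * C * D + C * Cp + Ci) + 1) * (A + T)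
      + Co * c⁻¹ * (Ci + C * Ce) * I := by
  have h1 : c * S ≤ (4 * C * D + C * Cp + Ci) * (A + T) + (Ci + C * Ce) * I := by
    have h4 := mul_le_mul_of_nonneg_left hE hC
    have h5 : 0 ≤ (C * Cp) * A := by positivity
    have h6 : 0 ≤ (4 * C * D) * T := by positivity
    have h7 : 0 ≤ Ci * T := by positivity
    linarith
  have h2 : S ≤ c⁻¹ * ((4 * C * D + C * Cp + Ci) * (A + T) + (Ci + C * Ce) * I) := by
    rwa [← div_eq_inv_mul, le_div_iff₀' hc]
  calc Co * (S + A)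
      ≤ Co * (c⁻¹ * ((4 * C * D + C * Cp + Ci) * (A + T) + (Ci + C * Ce) * I) + (A + T)) := by
        gcongr
        linarith
    _ = _ := by ring

/-! ### The adaptive closed loop -/

namespace ClosedLoop

variable {N M : ℕ} {ω : ℝ} {law : P.MPCLaw N M ω} {Γ : Matrix (Fin np) (Fin np) ℝ}
  {x xm : ℕ → Vec nx} {u : ℕ → Vec nu} {y : ℕ → Vec ny} {θ θe : ℕ → Vec np}
  {w : ℕ → Vec nw} {v : ℕ → Vec nx}

theorem estimate_mem (hcl : P.ClosedLoop law Γ x xm u y θ θe w v) (h0 : θe 0 ∈ P.Θ) :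
    ∀ k, θe k ∈ P.Θ
  | 0 => h0
  | k + 1 => (hcl.adaptation k).1

theorem input_mem (hcl : P.ClosedLoop law Γ x xm u y θ θe w v) (hN : 1 ≤ N)
    (h0 : θe 0 ∈ P.Θ) (k : ℕ) : u k ∈ P.U :=
  hcl.input k ▸ law.policy_mem hN (xm k) (hcl.estimate_mem h0 k)

theorem reachable (hcl : P.ClosedLoop law Γ x xm u y θ θe w v) (hN : 1 ≤ N)
    {X₀ : Set (Vec nx)} {W : Set (Vec nw)} (hx0 : x 0 ∈ X₀) (h0 : θe 0 ∈ P.Θ)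
    (hθ : ∀ k, θ k ∈ P.Θ) (hw : ∀ k, w k ∈ W) (k : ℕ) : P.Reachable X₀ W (x k) := by
  induction k with
  | zero => exact .init _ hx0
  | succ k ih =>
    rw [hcl.dynamics k]
    exact .step _ _ _ _ ih (hcl.input_mem hN h0 k) (hθ k) (hw k)

end ClosedLoop

theorem exists_closedLoop_bound (hweights : P.PositiveWeights) (hreg : P.Regular)
    (hlin : P.LinearlyParametrized) (hsteady : P.SteadyRegular) (hstable : P.OpenLoopStable)
    (hout : ∀ x, ∀ u ∈ P.U, ∀ θ ∈ P.Θ, ∀ θ' ∈ P.Θ, P.h x u θ = P.h x u θ')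
    {X₀ : Set (Vec nx)} {W : Set (Vec nw)} {V : Set (Vec nx)}
    {rd : Vec np → Vec nx × Vec nu × Vec ny}
    (hrd : ∀ θ ∈ P.Θ, P.IsOptimalSetpoint θ (rd θ)) {N M : ℕ} {ω : ℝ} (hN : 1 ≤ N)
    (hω : 0 < ω) (law : P.MPCLaw N M ω) {α : ℝ} (hα : 0 < α) (hdec : law.NominalDecrease α)
    {Γ : Matrix (Fin np) (Fin np) ℝ} (hΓ : P.AdmissibleGain X₀ W V Γ) :
    ∃ C₁ C₂ : ℝ, 0 < C₁ ∧ 0 < C₂ ∧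
      ∀ (x xm : ℕ → Vec nx) (u : ℕ → Vec nu) (y : ℕ → Vec ny) (θ θe : ℕ → Vec np)
        (w : ℕ → Vec nw) (v : ℕ → Vec nx), P.ClosedLoop law Γ x xm u y θ θe w v →
        x 0 ∈ X₀ → θe 0 ∈ P.Θ → (∀ k, θ k ∈ P.Θ) → (∀ k, w k ∈ W) → (∀ k, v k ∈ V) →
        ∀ K : ℕ, ∑ k ∈ Finset.range K,
            (‖y k - (rd (θ k)).2.2‖ ^ 2 + Metric.infDist (x k) P.X ^ 2)
          ≤ C₁ * ∑ k ∈ Finset.range K, (‖w k‖ ^ 2 + ‖v k‖ ^ 2 + ‖θ (k + 1) - θ k‖)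
            + C₂ * (‖θ 0 - θe 0‖ ^ 2 + ‖x 0 - (rd (θ 0)).1‖ ^ 2) := by
  have hyd : ∀ θ ∈ P.Θ, (rd θ).2.2 = P.yd := fun θ hθ =>
    hsteady.target_feasible θ hθ _ (hrd θ hθ)
  obtain ⟨c, C, hc0, hc1, hC, hcontr⟩ := law.exists_value_contraction hweights hreg hsteady
    hstable hN hω (fun θ hθ => ⟨rd θ, (hrd θ hθ).1, hyd θ hθ⟩) hα hdec
  obtain ⟨Co, hCo, houtput⟩ := law.exists_output_le hweights hreg hN hω hout
  obtain ⟨Ci, hCi, hinit⟩ := law.exists_value_initial_le hweights hsteady hstable hω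
  obtain ⟨cΓ, hcΓ, hΓlow⟩ := exists_norm_sq_le_wsq hΓ.1.inv
  obtain ⟨CΓ, hCΓ, hΓup⟩ := exists_wsq_le Γ⁻¹
  obtain ⟨Cp, hCp, hvar⟩ := hreg.exists_wsq_sub_le hΓ.1.inv.isHermitian
  obtain ⟨L, hL1, hL⟩ := hreg.exists_lipschitz_f
  -- The prediction error acts through the state mismatch and, with factor `cΓ`, through the change
  -- of estimate; the `2` splits `‖z + d‖²`.
  set C' := 2 * C * (1 + cΓ) with hC'def
  have hC' : 0 < C' := by positivity
  set D := 3 * L ^ 2 with hD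
  have hD0 : 0 < D := by positivity
  refine ⟨Co * (c⁻¹ * (4 * C' * D + C' * Cp + Ci) + 1), Co * c⁻¹ * (Ci + C' * CΓ),
    by positivity, by positivity, ?_⟩
  intro x xm u y θ θe w v hcl hx0 hθe0 hθ hw hv K
  have hθe := hcl.estimate_mem hθe0
  have hu := hcl.input_mem hN hθe0
  have hreach := hcl.reachable hN hx0 hθe0 hθ hw
  have hΦ : ∀ k, (1 - P.G (xm k) (u k) 0 * Γ * (P.G (xm k) (u k) 0).transpose).PosSemidef :=
    fun k => by
      rw [hcl.measurement k]
      exact hΓ.2 (x k) (hreach k) (u k) (hu k) (v k) (hv k)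
  set J : ℕ → ℝ := fun k => law.value (xm k) (θe k) with hJ
  set E : ℕ → ℝ := fun k => wsq Γ⁻¹ (θe k - θ k) with hE
  set z : ℕ → Vec nx := fun k => mulV (P.G (xm k) (u k) 0) (θ k - θe k) with hz
  set d : ℕ → Vec nx := fun k => xm (k + 1) - P.f (xm k) (u k) (θ k) 0 with hd
  set a : ℕ → ℝ := fun k => ‖w k‖ ^ 2 + ‖v k‖ ^ 2 with ha
  set p : ℕ → ℝ := fun k => Cp * ‖θ (k + 1) - θ k‖ with hp
  have hpred : ∀ k, xm (k + 1) - P.f (xm k) (u k) (θe k) 0 = z k + d k := fun k => by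
    simp only [hz, hd, mulV_sub]
    rw [hlin (xm k) (u k) (θe k) 0, hlin (xm k) (u k) (θ k) 0]
    abel
  have hproj : ∀ k, P.IsProjection Γ
      (θe k + mulV (Γ * (P.G (xm k) (u k) 0).transpose) (z k + d k)) (θe (k + 1)) :=
    fun k => hpred k ▸ hcl.adaptation k
  have hJ0 : ∀ k, 0 ≤ J k := fun k => law.value_nonneg hweights hN hω _ (hθe k)
  have hJs : ∀ k, J (k + 1) ≤ (1 - c) * J k + C' * (‖z k‖ ^ 2 + ‖d k‖ ^ 2) := fun k => by
    have h1 := hcontr (xm k) (xm (k + 1)) (θe k) (hθe k) (θe (k + 1)) (hθe (k + 1))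
    rw [← hcl.input k, hpred k] at h1
    have h2 := (hΓlow (θe (k + 1) - θe k)).trans
      (mul_le_mul_of_nonneg_left ((hproj k).wsq_step_le hreg hΓ.1 (hΦ k) (hθe k)) hcΓ.le)
    have h3 : ‖z k + d k‖ ^ 2 ≤ 2 * (‖z k‖ ^ 2 + ‖d k‖ ^ 2) :=
      (pow_le_pow_left₀ (norm_nonneg _) (norm_add_le _ _) 2).trans add_sq_le
    have h4 := mul_le_mul_of_nonneg_left h3 (show 0 ≤ C * (1 + cΓ) by positivity)
    have h5 := mul_le_mul_of_nonneg_left h2 hC.le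
    simp only [hJ, hC'def]
    linarith
  have hEs : ∀ k, E (k + 1) + ‖z k‖ ^ 2 ≤ E k + ‖d k‖ ^ 2 + p k := fun k => by
    have h1 := (hproj k).wsq_error_le hreg hΓ.1 (hΦ k) (hθ k)
    have h2 := hvar _ (hθe (k + 1)) _ (hθ k) _ (hθ (k + 1))
    simp only [hE, hp]
    linarith
  have hda : ∀ k, ‖d k‖ ^ 2 ≤ D * (a k + a (k + 1)) := fun k => by
    have h1 : d k = (P.f (x k) (u k) (θ k) (w k) - P.f (xm k) (u k) (θ k) 0) + v (k + 1) := by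
      simp only [hd]
      rw [hcl.measurement (k + 1), hcl.dynamics k]
      abel
    have h2 := hL (x k) (xm k) _ (hu k) _ (hu k) _ (hθ k) _ (hθ k) (w k) 0
    rw [sub_self, norm_zero, sub_self, norm_zero, sub_zero, add_zero, add_zero,
      hcl.measurement k, sub_add_cancel_left, norm_neg, ← hcl.measurement k] at h2
    have h3 : ‖d k‖ ≤ L * (‖v k‖ + ‖w k‖ + ‖v (k + 1)‖) := by
      rw [h1]
      refine (norm_add_le _ _).trans ?_
      have := mul_le_mul_of_nonneg_right hL1 (norm_nonneg (v (k + 1)))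
      linarith
    have h4 := pow_le_pow_left₀ (norm_nonneg _) h3 2
    have h5 : (‖v k‖ + ‖w k‖ + ‖v (k + 1)‖) ^ 2 ≤ 3 * (a k + a (k + 1)) := by
      simp only [ha]
      nlinarith [sq_nonneg (‖v k‖ - ‖w k‖), sq_nonneg (‖v k‖ - ‖v (k + 1)‖),
        sq_nonneg (‖w k‖ - ‖v (k + 1)‖), sq_nonneg ‖w (k + 1)‖]
    rw [mul_pow] at h4
    have h6 := mul_le_mul_of_nonneg_left h5 (sq_nonneg L)
    rw [hD]; linarith
  have ha0 : ∀ k, 0 ≤ a k := fun k => by positivity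
  have hp0 : ∀ k, 0 ≤ p k := fun k => by positivity
  have hyk : ∀ k, ‖y k - (rd (θ k)).2.2‖ ^ 2 + Metric.infDist (x k) P.X ^ 2
      ≤ Co * (J k + a k) := fun k => by
    have h1 := houtput (x k) (xm k) (θ k) (hθ k) (θe k) (hθe k)
    rw [hyd _ (hθ k), hcl.output k, hcl.input k]
    refine h1.trans ?_
    rw [hcl.measurement k, add_sub_cancel_left, ← hcl.measurement k]
    gcongr
    exact le_add_of_nonneg_left (sq_nonneg _)
  have hE0 : E 0 ≤ CΓ * ‖θ 0 - θe 0‖ ^ 2 := by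
    rw [norm_sub_rev]; exact hΓup _
  have hEnn : ∀ k, 0 ≤ E k := fun k => wsq_nonneg hΓ.1.inv.posSemidef _
  have hJi := hinit (x 0) (xm 0) (θ 0) (hθ 0) (θe 0) (hθe 0) (rd (θ 0)) (hrd _ (hθ 0)).1
    (rd (θe 0)) (hrd _ (hθe 0)).1 (hyd _ (hθ 0)) (hyd _ (hθe 0))
  rw [hcl.measurement 0, add_sub_cancel_left, ← hcl.measurement 0] at hJi
  set I := ‖θ 0 - θe 0‖ ^ 2 + ‖x 0 - (rd (θ 0)).1‖ ^ 2 with hI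
  have hθI : ‖θ 0 - θe 0‖ ^ 2 ≤ I := le_add_of_nonneg_right (sq_nonneg _)
  -- The initial value depends on `v 0`, which is in the noise sum only for positive `K`.
  rcases K with _ | n
  · simp only [Finset.range_zero, Finset.sum_empty, mul_zero, zero_add]
    positivity
  have hsum := sum_le_of_contraction hc1 hC'.le hD0.le hJ0
    hEnn ha0 hp0 hJs hEs hda n
  set A := ∑ k ∈ Finset.range (n + 1), a k with hA
  set T := ∑ k ∈ Finset.range (n + 1), ‖θ (k + 1) - θ k‖ with hT
  have hA0 : 0 ≤ A := Finset.sum_nonneg fun k _ => ha0 k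
  have hT0 : 0 ≤ T := Finset.sum_nonneg fun k _ => norm_nonneg _
  have hv0 : ‖v 0‖ ^ 2 ≤ A :=
    (le_add_of_nonneg_left (sq_nonneg ‖w 0‖)).trans
      (Finset.single_le_sum (f := a) (fun k _ => ha0 k) (by simp))
  have hpT : ∑ k ∈ Finset.range (n + 1), p k = Cp * T := by rw [hT, Finset.mul_sum]
  rw [hpT] at hsum
  have hAT : ∑ k ∈ Finset.range (n + 1), (‖w k‖ ^ 2 + ‖v k‖ ^ 2 + ‖θ (k + 1) - θ k‖)
      = A + T := by rw [hA, hT, ← Finset.sum_add_distrib]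
  rw [hAT]
  have h3 := Finset.sum_le_sum fun k (_ : k ∈ Finset.range (n + 1)) => hyk k
  rw [← Finset.mul_sum, Finset.sum_add_distrib (f := J) (g := a)] at h3
  have hJI : J 0 ≤ Ci * (A + I) :=
    hJi.trans (mul_le_mul_of_nonneg_left (by linarith) hCi.le)
  have hEI : E 0 ≤ CΓ * I := hE0.trans (mul_le_mul_of_nonneg_left hθI hCΓ.le)
  exact h3.trans (bound_of_weighted_sum_le hc0 hC'.le hD0.le hCp.le hCi.le hCo.le hA0 hT0
    hJI hEI hsum)

end Problem
end AdaptiveMPC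

theorem mainTheorem1 {nx nu np nw ny r : ℕ} (P : AdaptiveMPC.Problem nx nu np nw ny r)
    (hweights : P.PositiveWeights)
    (hreg : P.Regular)
    (hlin : P.LinearlyParametrized)
    (hsteady : P.SteadyRegular)
    (hstable : P.OpenLoopStable)
    (hout : ∀ x, ∀ u ∈ P.U, ∀ θ ∈ P.Θ, ∀ θ' ∈ P.Θ, P.h x u θ = P.h x u θ')
    (X₀ : Set (AdaptiveMPC.Vec nx)) (W : Set (AdaptiveMPC.Vec nw))
    (V : Set (AdaptiveMPC.Vec nx))
    (hX₀ : IsCompact X₀) (hW : IsCompact W) (hV : IsCompact V)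
    (rd : AdaptiveMPC.Vec np →
      AdaptiveMPC.Vec nx × AdaptiveMPC.Vec nu × AdaptiveMPC.Vec ny)
    (hrd : ∀ θ ∈ P.Θ, P.IsOptimalSetpoint θ (rd θ)) :
    -- horizons and weights with nominal decrease can be chosen
    (∀ ω : ℝ, 1 ≤ ω → ∀ M : ℕ, ∃ N : ℕ, 1 ≤ N ∧ ∃ α : ℝ, 0 < α ∧
      ∀ law : P.MPCLaw N M ω, law.NominalDecrease α) ∧
    (∃ M₀ : ℕ, ∀ M : ℕ, M₀ ≤ M → ∃ ω₀ : ℝ, 1 ≤ ω₀ ∧ ∀ ω : ℝ, ω₀ < ω → ∀ N : ℕ, 1 ≤ N →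
      ∃ α : ℝ, 0 < α ∧ ∀ law : P.MPCLaw N M ω, law.NominalDecrease α) ∧
    -- the MPC problem has minimizers, so that an MPC law exists
    (∀ (N M : ℕ) (ω : ℝ), 1 ≤ N → 0 < ω → Nonempty (P.MPCLaw N M ω)) ∧
    -- an admissible gain can be chosen
    (∃ Γ, P.AdmissibleGain X₀ W V Γ) ∧
    -- every such choice achieves the objective
    (∀ (N M : ℕ) (ω : ℝ), 1 ≤ N → 0 < ω → ∀ law : P.MPCLaw N M ω,
      (∃ α : ℝ, 0 < α ∧ law.NominalDecrease α) →
      ∀ Γ, P.AdmissibleGain X₀ W V Γ →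
      ∃ C₁ C₂ : ℝ, 0 < C₁ ∧ 0 < C₂ ∧
        ∀ (x xm : ℕ → AdaptiveMPC.Vec nx) (u : ℕ → AdaptiveMPC.Vec nu)
          (y : ℕ → AdaptiveMPC.Vec ny) (θ θe : ℕ → AdaptiveMPC.Vec np)
          (w : ℕ → AdaptiveMPC.Vec nw) (v : ℕ → AdaptiveMPC.Vec nx),
          P.ClosedLoop law Γ x xm u y θ θe w v →
          x 0 ∈ X₀ → θe 0 ∈ P.Θ →
          (∀ k, θ k ∈ P.Θ) → (∀ k, w k ∈ W) → (∀ k, v k ∈ V) →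
          ∀ K : ℕ,
            ∑ k ∈ Finset.range K,
                (‖y k - (rd (θ k)).2.2‖ ^ 2 + Metric.infDist (x k) P.X ^ 2)
              ≤ C₁ * ∑ k ∈ Finset.range K,
                    (‖w k‖ ^ 2 + ‖v k‖ ^ 2 + ‖θ (k + 1) - θ k‖)
                + C₂ * (‖θ 0 - θe 0‖ ^ 2 + ‖x 0 - (rd (θ 0)).1‖ ^ 2)) := by
  refine ⟨fun ω hω M => ?_, ?_, fun N M ω _ _ => hreg.nonempty_mpcLaw N M ω,
    hreg.exists_admissibleGain hlin hstable hX₀ hW hV, fun N M ω hN hω law ⟨α, hα, hdec⟩ Γ hΓ =>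
      AdaptiveMPC.Problem.exists_closedLoop_bound hweights hreg hlin hsteady hstable hout hrd hN
        hω law hα hdec hΓ⟩
  · obtain ⟨N, hN, h⟩ := AdaptiveMPC.Problem.exists_horizon_nominalDecrease hweights hstable
      (zero_le_one.trans hω) M
    exact ⟨N, hN, 1 / 2, by norm_num, h⟩
  · obtain ⟨M₀, h⟩ := AdaptiveMPC.Problem.exists_weight_nominalDecrease hweights hstable
    refine ⟨M₀, fun M hM => ?_⟩
    obtain ⟨ω₀, hω₀, h'⟩ := h M hM
    exact ⟨ω₀, hω₀, fun ω hω N hN => ⟨1, one_pos, h' ω hω N hN⟩⟩
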